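/- Let $X_n$ be a finite-dimensional simple Lie algebra over $\mathbb{C}$ with simple roots $\alpha_1,\dots,\alpha_n$ and fundamental weights $\Lambda_1,\dots,\Lambda_n$ (with respect to a Cartan subalgebra and a base of the root system). Let $(\cdot|\cdot)$ be the invariant form normalized by $(\alpha|\alpha)=2$ for a long root $\alpha$, put $t_a=2/(\alpha_a|\alpha_a)\in\{1,2,3\}$ and $C_{ab}=t_a(\alpha_a|\alpha_b)$, so that $\alpha_a=\sum_b C_{ba}\Lambda_b$. Let $x_a=e^{\Lambda_a}$ and $y_a=e^{-\alpha_a}=\prod_{b}x_b^{-(\alpha_a|\alpha_b)t_b}$; write $y=y(x)$. Let $H=\{(a,m)\mid 1\le a\le n,\ m\in\mathbb{Z}_{\ge1}\}$ and $$B_{am,bk}=2\min(t_bm,t_ak)-\min(t_bm,t_a(k+1))-\min(t_bm,t_a(k-1)).$$ There is a unique family $(\tilde Q^{(a)}_m(y))_{(a,m)\in H}$ of invertible elements of $\mathbb{C}[[y]]=\mathbb{C}[[y_1,\dots,y_n]]$ such that, with $\tilde Q^{(a)}_0=1$, (i) for all $(a,m)\in H$, $$(\tilde Q_m^{(a)})^2=\tilde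 Q_{m+1}^{(a)}\tilde Q_{m-1}^{(a)}+y_a^m(\tilde Q_m^{(a)})^2\prod_{(b,k)\in H}(\tilde Q_k^{(b)})^{-(\alpha_a|\alpha_b)B_{am,bk}}$$ (the exponents are integers, only finitely many of them nonzero for given $(a,m)$), and (ii) for every $a$ the limit $\lim_{m\to\infty}\tilde Q_m^{(a)}(y)$ exists in the standard (adic) topology of $\mathbb{C}[[y]]$, i.e. each coefficient is eventually constant in $m$. Put $Q^{(a)}_1(x)=x_a\,\tilde Q^{(a)}_1(y(x))$. For a family $N=(N_m^{(a)})_{(a,m)\in H}$ of non-negative integers with finite support let $$P_m^{(a)}(N)=-\sum_{(b,k)\in H}(\alpha_a|\alpha_b)\min(t_bm,t_ak)N_k^{(b)},\qquad K(0,N)=\prod_{(a,m)\in H}\binom{P_m^{(a)}(N)+N_m^{(a)}}{N_m^{(a)}},$$ where $\binom{z}{j}=z(z-1)\cdots(z-j+1)/j!$, and let $$\tilde K^0(y)=\sum_N K(0,N)\prod_{a=1}^n y_a^{\sum_m mN_m^{(a)}}\in\mathbb{C}[[y]],\qquad K^0(x)=\tilde K^0(y(x)).$$ Then, as Laurent series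 in $x=(x_1,\dots,x_n)$, $$K^0(x)=\det_{1\le a,b\le n}\left(\frac{\partial Q_1^{(a)}}{\partial x_b}(x)\right).$$ No Weyl-group invariance of the $Q^{(a)}_1(x)$ is assumed. -/

import Mathlib

open Filter

noncomputable section

/-! ### Cartan data -/

/-- The numerical data attached to a choice of simple roots `α_a`, `a ∈ I`: the Gram matrix
`(α_a|α_b)`, the integers `t_a = 2 / (α_a|α_a)` and the Cartan matrix `C_ab = t_a (α_a|α_b)`. -/
structure CartanData (I : Type*) [Fintype I] where
  /-- The values `(α_a|α_b)`. -/
  gram : I → I → ℚ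
  /-- The integers `t_a`. -/
  t : I → ℕ
  /-- The Cartan matrix `C_ab`. -/
  cartan : I → I → ℤ
  gram_symm : ∀ a b, gram a b = gram b a
  t_mul_gram_self : ∀ a, (t a : ℚ) * gram a a = 2
  cartan_eq : ∀ a b, (cartan a b : ℚ) = t a * gram a b
  gram_pos : ∀ z : I → ℤ, z ≠ 0 → 0 < ∑ a, ∑ b, (z a : ℚ) * gram a b * z b

namespace CartanData

variable {I : Type*} [Fintype I] (D : CartanData I)

lemma t_pos (a : I) : 0 < D.t a := by
  rcases Nat.eq_zero_or_pos (D.t a) with h | h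
  · have := D.t_mul_gram_self a
    simp [h] at this
  · exact h

/-- The function `B_{am,bk}`. -/
def B (a : I) (m : ℕ) (b : I) (k : ℕ) : ℤ :=
  2 * (min (D.t b * m) (D.t a * k) : ℕ) - (min (D.t b * m) (D.t a * (k + 1)) : ℕ)
    - (min (D.t b * m) (D.t a * (k - 1)) : ℕ)

/-- The integer `(α_a|α_b) B_{am,bk}`; see `CartanData.cast_expo` for its integrality. -/
def expo (a : I) (m : ℕ) (b : I) (k : ℕ) : ℤ := (D.gram a b * D.B a m b k).num

lemma cartan_self (a : I) : D.cartan a a = 2 := by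
  have := D.cartan_eq a a
  rw [D.t_mul_gram_self a] at this
  exact_mod_cast this

lemma t_mul_cartan (a b : I) : (D.t b : ℤ) * D.cartan a b = D.t a * D.cartan b a := by
  have h1 := D.cartan_eq a b
  have h2 := D.cartan_eq b a
  rw [D.gram_symm b a] at h2
  have : (D.t b : ℚ) * D.cartan a b = D.t a * D.cartan b a := by rw [h1, h2]; ring
  exact_mod_cast this

lemma cartan_mul_lt (a b : I) (h : a ≠ b) : D.cartan a b * D.cartan b a < 4 := by
  classical
  have hp := D.gram_pos (Pi.single a 2 - Pi.single b (D.cartan b a)) (by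
    intro h0
    have := congrFun h0 a
    simp [h] at this)
  have e : ∀ c, ((Pi.single a 2 - Pi.single b (D.cartan b a) : I → ℤ) c : ℚ)
      = (Pi.single a 2 - Pi.single b (D.cartan b a : ℚ) : I → ℚ) c := by
    intro c
    simp only [Pi.sub_apply, Pi.single_apply]
    push_cast
    split_ifs <;> simp
  simp only [e] at hp
  simp only [Pi.sub_apply, sub_mul, mul_sub, Finset.sum_sub_distrib, Pi.single_apply, ite_mul,
    mul_ite, zero_mul, mul_zero, Finset.sum_ite_eq', Finset.mem_univ, if_true] at hp
  have ha : (0 : ℚ) < D.t a := by exact_mod_cast D.t_pos a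
  have h1 := D.cartan_eq a b
  have h2 := D.cartan_eq b a
  have h3 := D.t_mul_gram_self a
  have h4 := D.t_mul_gram_self b
  have hb : (0 : ℚ) < D.t b := by exact_mod_cast D.t_pos b
  rw [D.gram_symm b a] at hp h2
  have h5 : 0 < (D.t a : ℚ) * (4 * D.gram a a - 4 * D.cartan b a * D.gram a b
      + D.cartan b a ^ 2 * D.gram b b) := by
    apply mul_pos ha
    linarith
  have h6 : (D.cartan b a : ℚ) * D.gram b b = 2 * D.gram a b := by
    rw [h2]; linear_combination D.gram a b * h4
  have h7 : (D.t a : ℚ) * (4 * D.gram a a - 4 * D.cartan b a * D.gram a b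
      + D.cartan b a ^ 2 * D.gram b b) = 8 - 2 * (D.cartan a b * D.cartan b a) := by
    rw [h1]
    linear_combination 4 * h3 + (D.t a : ℚ) * D.cartan b a * h6
  rw [h7] at h5
  have : (D.cartan a b : ℚ) * D.cartan b a < 4 := by linarith
  exact_mod_cast this

/-- A common divisor of `t_a` and `t_b` divides `B_{am,bk}`. -/
lemma dvd_B {a b : I} (d : ℕ) (ha : d ∣ D.t a) (hb : d ∣ D.t b) (m k : ℕ) :
    (d : ℤ) ∣ D.B a m b k := by
  obtain ⟨r, hr⟩ := ha
  obtain ⟨s, hs⟩ := hb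
  unfold B
  rw [hr, hs]
  simp only [mul_assoc, Nat.mul_min_mul_left, Nat.cast_mul]
  exact dvd_sub (dvd_sub (Dvd.dvd.mul_left (dvd_mul_right _ _) _) (dvd_mul_right _ _))
    (dvd_mul_right _ _)

lemma exists_int_gram_mul_B (a b : I) (m k : ℕ) :
    ∃ z : ℤ, (z : ℚ) = D.gram a b * D.B a m b k := by
  have hta : (D.t a : ℚ) ≠ 0 := by exact_mod_cast (D.t_pos a).ne'
  have htb : (D.t b : ℚ) ≠ 0 := by exact_mod_cast (D.t_pos b).ne'
  have h1 := D.cartan_eq a b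
  have h2 := D.cartan_eq b a
  rw [D.gram_symm b a] at h2
  have keyA : D.t a ∣ D.t b → ∃ z : ℤ, (z : ℚ) = D.gram a b * D.B a m b k := by
    intro hd
    obtain ⟨q, hq⟩ := D.dvd_B (D.t a) dvd_rfl hd m k
    refine ⟨D.cartan a b * q, ?_⟩
    rw [hq]; push_cast; rw [h1]; ring
  have keyB : D.t b ∣ D.t a → ∃ z : ℤ, (z : ℚ) = D.gram a b * D.B a m b k := by
    intro hd
    obtain ⟨q, hq⟩ := D.dvd_B (D.t b) hd dvd_rfl m k
    refine ⟨D.cartan b a * q, ?_⟩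
    rw [hq]; push_cast; rw [h2]; ring
  by_cases hab : a = b
  · subst hab; exact keyA dvd_rfl
  by_cases h0 : D.gram a b = 0
  · exact ⟨0, by simp [h0]⟩
  have hlt := D.cartan_mul_lt a b hab
  have hpos : 0 < D.cartan a b * D.cartan b a := by
    have : (0 : ℚ) < D.cartan a b * D.cartan b a := by
      rw [h1, h2]
      have ha : (0 : ℚ) < D.t a := by exact_mod_cast D.t_pos a
      have hb : (0 : ℚ) < D.t b := by exact_mod_cast D.t_pos b
      have : (D.t a : ℚ) * D.gram a b * (D.t b * D.gram a b)
        = D.t a * D.t b * (D.gram a b) ^ 2 := by ring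
      rw [this]; positivity
    exact_mod_cast this
  have hs := D.t_mul_cartan a b
  have hunit : IsUnit (D.cartan a b) ∨ IsUnit (D.cartan b a) := by
    rw [Int.isUnit_iff, Int.isUnit_iff]
    by_contra hcon
    push Not at hcon
    obtain ⟨⟨u1, u2⟩, u3, u4⟩ := hcon
    rcases lt_trichotomy (D.cartan a b) 0 with hx | hx | hx
    · have hy : D.cartan b a < 0 := by nlinarith
      have : D.cartan a b ≤ -2 := by omega
      have : D.cartan b a ≤ -2 := by omega
      nlinarith
    · simp [hx] at hpos
    · have hy : 0 < D.cartan b a := by nlinarith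
      have : 2 ≤ D.cartan a b := by omega
      have : 2 ≤ D.cartan b a := by omega
      nlinarith
  rcases hunit with hu | hu
  · apply keyA
    rw [← Int.natCast_dvd_natCast, ← hu.dvd_mul_right, hs]
    exact dvd_mul_right _ _
  · apply keyB
    rw [← Int.natCast_dvd_natCast, ← hu.dvd_mul_right, ← hs]
    exact dvd_mul_right _ _

lemma cast_expo (a b : I) (m k : ℕ) : (D.expo a m b k : ℚ) = D.gram a b * D.B a m b k := by
  obtain ⟨z, hz⟩ := D.exists_int_gram_mul_B a b m k
  rw [expo, ← hz]
  simp

lemma B_eq_zero {a b : I} {m k : ℕ} (h : D.t b * m < k) : D.B a m b k = 0 := by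
  have ha := D.t_pos a
  have h3 : D.t b * m ≤ D.t a * (k - 1) := by
    calc D.t b * m ≤ 1 * (k - 1) := by omega
      _ ≤ D.t a * (k - 1) := Nat.mul_le_mul_right _ ha
  have h1 : D.t b * m ≤ D.t a * k := h3.trans (Nat.mul_le_mul_left _ (by omega))
  have h2 : D.t b * m ≤ D.t a * (k + 1) := h1.trans (Nat.mul_le_mul_left _ (by omega))
  rw [B, min_eq_left h1, min_eq_left h2, min_eq_left h3]
  ring

/-- For fixed `(a, m)` only finitely many of the exponents `(α_a|α_b) B_{am,bk}` are nonzero, so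
that the product in the `Q`-system is finite. -/
lemma finite_expo_ne_zero (a : I) (m : ℕ) :
    {p : I × ℕ+ | D.expo a m p.1 p.2 ≠ 0}.Finite := by
  have hfin : ((Set.univ : Set I) ×ˢ
      (PNat.val ⁻¹' Set.Iic (∑ b, D.t b * m) : Set ℕ+)).Finite :=
    Set.finite_univ.prod ((Set.finite_Iic _).preimage PNat.coe_injective.injOn)
  refine hfin.subset ?_
  rintro ⟨b, k⟩ hp
  refine ⟨Set.mem_univ _, ?_⟩
  by_contra hk
  simp only [Set.mem_preimage, Set.mem_Iic, not_le] at hk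
  refine hp ?_
  have hle : D.t b * m ≤ ∑ b, D.t b * m :=
    Finset.single_le_sum (f := fun b => D.t b * m) (fun _ _ => Nat.zero_le _) (Finset.mem_univ b)
  change D.expo a m b (k : ℕ) = 0
  rw [expo, D.B_eq_zero (lt_of_le_of_lt hle hk)]
  simp

/-! ### The `Q`-system in power series in `y` -/

/-- A family `Q̃_m^{(a)}(y)` of invertible power series in `y = (y_a)` (with `Q̃_0^{(a)} = 1`)
satisfying the `Q`-system and the convergence property. Convergence is with respect to the standard
(adic) topology of `ℂ[[y]]`: every coefficient is eventually constant. -/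
structure IsQSystem (Q : I → ℕ → (MvPowerSeries I ℂ)ˣ) : Prop where
  zero : ∀ a, Q a 0 = 1
  rel : ∀ (a : I) (m : ℕ), 1 ≤ m →
    (Q a m : MvPowerSeries I ℂ) ^ 2 =
      (Q a (m + 1) : MvPowerSeries I ℂ) * (Q a (m - 1) : MvPowerSeries I ℂ) +
      MvPowerSeries.X a ^ m * (Q a m : MvPowerSeries I ℂ) ^ 2 *
        ((∏ᶠ p : I × ℕ+, Q p.1 p.2 ^ (-D.expo a m p.1 p.2) : (MvPowerSeries I ℂ)ˣ) :
          MvPowerSeries I ℂ)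
  conv : ∀ a, ∃ L : MvPowerSeries I ℂ, ∀ d, ∀ᶠ m in atTop,
    MvPowerSeries.coeff d (Q a m : MvPowerSeries I ℂ) = MvPowerSeries.coeff d L

/-! ### The series `K̃^ν(y)` -/

open Classical in
/-- `γ_m^{(a)}(ν) = ∑_k min(m,k) ν_k^{(a)}`. -/
def gamma (_D : CartanData I) (ν : I × ℕ+ →₀ ℕ) (a : I) (m : ℕ) : ℕ :=
  ν.sum fun p c => if p.1 = a then min m p.2 * c else 0

/-- `P_m^{(a)}(ν,N) = γ_m^{(a)}(ν) - ∑_{(b,k)} (α_a|α_b) min(t_b m, t_a k) N_k^{(b)}`. -/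
def vacancy (ν N : I × ℕ+ →₀ ℕ) (a : I) (m : ℕ) : ℚ :=
  D.gamma ν a m -
    N.sum fun p c => D.gram a p.1 * (min (D.t p.1 * m) (D.t a * p.2) : ℕ) * c

/-- `K(ν,N) = ∏_{(a,m)} binom(P_m^{(a)} + N_m^{(a)}, N_m^{(a)})` with the polynomial binomial
coefficient; the factors with `N_m^{(a)} = 0` are `1`. -/
def KNum (ν N : I × ℕ+ →₀ ℕ) : ℚ :=
  N.prod fun p c => Ring.choose (D.vacancy ν N p.1 p.2 + c) c

open Classical in
/-- The exponent `(∑_m m N_m^{(a)})_a` of `y` attached to `N`. -/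
def yDegree (_D : CartanData I) (N : I × ℕ+ →₀ ℕ) (a : I) : ℕ :=
  N.sum fun p c => if p.1 = a then (p.2 : ℕ) * c else 0

/-- Only finitely many `N` contribute to a given monomial in `y`. -/
lemma finite_yDegree_eq (d : I → ℕ) : {N : I × ℕ+ →₀ ℕ | D.yDegree N = d}.Finite := by
  classical
  have key : ∀ (N : I × ℕ+ →₀ ℕ), D.yDegree N = d → ∀ p : I × ℕ+, N p ≠ 0 →
      (p.2 : ℕ) * N p ≤ ∑ a, d a := by
    intro N hN p hp
    have h1 : (p.2 : ℕ) * N p ≤ D.yDegree N p.1 := by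
      unfold yDegree Finsupp.sum
      have := Finset.single_le_sum
        (f := fun q : I × ℕ+ => if q.1 = p.1 then (q.2 : ℕ) * N q else 0)
        (fun _ _ => Nat.zero_le _) (Finsupp.mem_support_iff.mpr hp)
      simpa using this
    rw [hN] at h1
    exact h1.trans (Finset.single_le_sum (f := d) (fun _ _ => Nat.zero_le _) (Finset.mem_univ _))
  set s : ℕ := ∑ a, d a with hs
  have hfin : ((Set.univ : Set I) ×ˢ (PNat.val ⁻¹' Set.Iic s : Set ℕ+)).Finite :=
    Set.finite_univ.prod ((Set.finite_Iic _).preimage PNat.coe_injective.injOn)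
  let M : I × ℕ+ →₀ ℕ := Finsupp.onFinset hfin.toFinset
    (fun p => if p ∈ hfin.toFinset then s else 0) (by intro p hp; by_contra h; simp [h] at hp)
  refine (Set.finite_Iic M).subset ?_
  intro N hN p
  by_cases hp : N p = 0
  · simp [hp]
  have h := key N hN p hp
  have hpp : 1 ≤ (p.2 : ℕ) := p.2.pos
  have hN1 : 1 ≤ N p := Nat.one_le_iff_ne_zero.mpr hp
  have hmem : p ∈ hfin.toFinset := by
    rw [Set.Finite.mem_toFinset]
    refine ⟨Set.mem_univ _, ?_⟩
    simp only [Set.mem_preimage, Set.mem_Iic]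
    exact le_trans (by simpa using Nat.mul_le_mul_left (p.2 : ℕ) hN1) h
  have hM : M p = s := by simp only [M, Finsupp.onFinset_apply, if_pos hmem]
  rw [hM]
  exact le_trans (by simpa using Nat.mul_le_mul_right (N p) hpp) h

/-- `K̃^ν(y) = ∑_N K(ν,N) ∏_a y_a^{∑_m m N_m^{(a)}}`. -/
def KTilde (ν : I × ℕ+ →₀ ℕ) : MvPowerSeries I ℂ :=
  fun d => ∑ᶠ N ∈ {N : I × ℕ+ →₀ ℕ | D.yDegree N = ⇑d}, (D.KNum ν N : ℂ)

/-! ### Laurent series in `x` -/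

/-- The weight lattice; the weight `∑_a λ_a Λ_a` is given by its coordinates `λ_a` with respect to
the fundamental weights `Λ_a`. -/
def Weight (_D : CartanData I) : Type _ := I → ℤ

instance : AddCommGroup D.Weight := inferInstanceAs (AddCommGroup (I → ℤ))

/-- The fundamental weight `Λ_a`. -/
def fundWeight (a : I) : D.Weight := by
  classical exact (Pi.single a 1 : I → ℤ)

/-- The simple root `α_a = ∑_b C_ba Λ_b`. -/
def simpleRoot (a : I) : D.Weight := fun b => D.cartan b a

/-- The element `∑_a c_a α_a` of the root lattice, for natural numbers `c_a`. -/
def rootComb : (I →₀ ℕ) →+ D.Weight where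
  toFun c := ∑ a, c a • D.simpleRoot a
  map_zero' := by simp
  map_add' c d := by simp [add_smul, Finset.sum_add_distrib]

lemma rootComb_apply (c : I →₀ ℕ) (b : I) :
    D.rootComb c b = ∑ a, (c a : ℤ) * D.cartan b a := by
  have h : D.rootComb c b = (∑ a, c a • (fun b => D.cartan b a) : I → ℤ) b := rfl
  rw [h]
  simp [Finset.sum_apply]

lemma rootComb_injective : Function.Injective D.rootComb := by
  intro c d h
  by_contra hne
  have hz : (fun a => (c a : ℤ) - d a) ≠ 0 := by
    intro h0
    apply hne
    ext a
    have := congrFun h0 a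
    simp only [Pi.zero_apply] at this
    omega
  have hpos := D.gram_pos _ hz
  have hrow : ∀ b, ∑ a, D.gram b a * ((c a : ℚ) - d a) = 0 := by
    intro b
    have h1 : D.rootComb c b = D.rootComb d b := by rw [h]
    rw [rootComb_apply, rootComb_apply] at h1
    have h2 : (∑ a, (c a : ℚ) * D.cartan b a) = ∑ a, (d a : ℚ) * D.cartan b a := by
      exact_mod_cast h1
    have h3 : (D.t b : ℚ) * ∑ a, D.gram b a * ((c a : ℚ) - d a) = 0 := by
      rw [Finset.mul_sum]
      rw [← sub_eq_zero, ← Finset.sum_sub_distrib] at h2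
      rw [← h2]
      refine Finset.sum_congr rfl fun a _ => ?_
      rw [D.cartan_eq]; ring
    have hb : (D.t b : ℚ) ≠ 0 := by exact_mod_cast (D.t_pos b).ne'
    exact (mul_eq_zero.mp h3).resolve_left hb
  have h0 : ∑ a, ∑ b, (((c a : ℤ) - d a : ℤ) : ℚ) * D.gram a b * (((c b : ℤ) - d b : ℤ) : ℚ)
      = 0 := by
    refine Finset.sum_eq_zero fun a _ => ?_
    have := hrow a
    push_cast
    simp only [mul_assoc]
    rw [← Finset.mul_sum, this, mul_zero]
  rw [h0] at hpos
  exact lt_irrefl _ hpos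

/-- The reversed dominance order on weights: `λ ≤ μ` if and only if `λ - μ` is a sum of simple
roots. A Laurent series is then a formal sum of monomials `e^λ` with well-partially-ordered
support; the support of `x^λ f(y(x))` lies in `{μ | λ ≤ μ}`. -/
instance : PartialOrder D.Weight where
  le lam mu := ∃ c : I →₀ ℕ, lam = mu + D.rootComb c
  le_refl lam := ⟨0, by simp⟩
  le_trans lam mu nu := by
    rintro ⟨c, rfl⟩ ⟨d, rfl⟩
    exact ⟨d + c, by rw [map_add, add_assoc]⟩
  le_antisymm lam mu := by
    rintro ⟨c, hc⟩ ⟨d, hd⟩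
    have h : D.rootComb (d + c) = D.rootComb 0 := by
      rw [map_zero, map_add]
      rw [hd, add_assoc] at hc
      exact left_eq_add.mp hc
    have h2 := D.rootComb_injective h
    have hc0 : c = 0 := by
      ext a
      have := DFunLike.congr_fun h2 a
      simp only [Finsupp.add_apply, Finsupp.zero_apply] at this ⊢
      omega
    rw [hc, hc0]; simp

lemma Weight.le_iff {lam mu : D.Weight} :
    lam ≤ mu ↔ ∃ c : I →₀ ℕ, lam = mu + D.rootComb c := Iff.rfl

instance : IsOrderedCancelAddMonoid D.Weight where
  add_le_add_left lam mu h nu := by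
    obtain ⟨c, rfl⟩ := h
    exact ⟨c, by abel⟩
  le_of_add_le_add_left lam mu nu h := by
    obtain ⟨c, hc⟩ := h
    exact ⟨c, by rw [add_assoc] at hc; exact add_left_cancel hc⟩

/-- The ring of Laurent series in `x = (x_a)`, where `x_a = e^{Λ_a}`. -/
abbrev Laurent : Type _ := HahnSeries D.Weight ℂ

/-- The monomial `e^λ = ∏_a x_a^{λ_a}`. -/
def mono (lam : D.Weight) : D.Laurent := HahnSeries.single lam 1

/-- The ring homomorphism `f(y) ↦ f(y(x))`, where
`y_a = e^{-α_a} = ∏_b x_b^{-(α_a|α_b) t_b}`. -/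
def ySubst : MvPowerSeries I ℂ →+* D.Laurent :=
  (HahnSeries.embDomainRingHom (-D.rootComb)
    (fun c d h => D.rootComb_injective (neg_injective h))
    (fun c d => by
      simp only [AddMonoidHom.neg_apply]
      constructor
      · rintro ⟨e, he⟩
        have : D.rootComb d = D.rootComb (c + e) := by
          rw [map_add]
          have h2 := congrArg (fun w => w + D.rootComb c + D.rootComb d) he
          simp only [neg_add_cancel, zero_add] at h2
          rw [h2]; abel
        rw [D.rootComb_injective this]
        exact le_self_add
      · intro h
        obtain ⟨e, rfl⟩ := exists_add_of_le h
        exact ⟨e, by rw [map_add]; abel⟩)).comp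
    (HahnSeries.toMvPowerSeries (σ := I) (R := ℂ)).symm.toRingHom

/-- The partial derivative `∂/∂x_b`: it sends `e^λ` to `λ_b e^{λ - Λ_b}`. -/
def pderiv (b : I) (f : D.Laurent) : D.Laurent where
  coeff lam := ((lam b : ℂ) + 1) * f.coeff (lam + D.fundWeight b)
  isPWO_support' := by
    refine (f.isPWO_support.image_of_monotone
      (f := fun mu => mu - D.fundWeight b) ?_).mono ?_
    · rintro lam mu ⟨c, rfl⟩
      exact ⟨c, add_sub_right_comm _ _ _⟩
    · intro lam hlam
      refine ⟨lam + D.fundWeight b, ?_, by simp⟩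
      intro h
      apply hlam
      simp only [h, mul_zero]

/-- `Q_m^{(a)}(x) = x_a^m Q̃_m^{(a)}(y(x))`. -/
def QLaurent (Q : I → ℕ → (MvPowerSeries I ℂ)ˣ) (a : I) (m : ℕ) : D.Laurent :=
  D.mono (m • D.fundWeight a) * D.ySubst (Q a m)

/-- `K^ν(x) = (∏_{(a,m)} x_a^{m ν_m^{(a)}}) K̃^ν(y(x))`. -/
def KLaurent (ν : I × ℕ+ →₀ ℕ) : D.Laurent :=
  D.mono (ν.sum fun p c => ((p.2 : ℕ) * c) • D.fundWeight p.1) * D.ySubst (D.KTilde ν)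

end CartanData

/-! ### The Cartan data of a simple Lie algebra -/

namespace RootPairing

variable {ι M N : Type*} [Fintype ι] [AddCommGroup M] [Module ℂ M] [AddCommGroup N] [Module ℂ N]
  (P : RootPairing ι ℂ M N) [P.IsCrystallographic]

/-- The squared length of the longest root with respect to the canonical Weyl-invariant form. -/
def longSq (i : ι) : ℤ :=
  (Finset.univ : Finset ι).sup' ⟨i, Finset.mem_univ i⟩ (P.posRootForm ℤ).rootLength

/-- The invariant form on roots normalized such that `(α|α) = 2` for a long root `α`. -/
def stdForm (i j : ι) : ℚ :=
  2 * ((P.posRootForm ℤ).posForm (P.rootSpanMem ℤ i) (P.rootSpanMem ℤ j) : ℤ) / (P.longSq i : ℤ)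

/-- The number `2 / (α|α)`, as a natural number. -/
def lengthRatio (i : ι) : ℕ := (2 / P.stdForm i i).num.toNat

lemma stdForm_self (i : ι) :
    P.stdForm i i = 2 * ((P.posRootForm ℤ).rootLength i : ℤ) / (P.longSq i : ℤ) := rfl

lemma longSq_eq (i j : ι) : P.longSq i = P.longSq j := rfl

lemma longSq_pos (i : ι) : 0 < P.longSq i :=
  lt_of_lt_of_le ((P.posRootForm ℤ).rootLength_pos i)
    (Finset.le_sup' (P.posRootForm ℤ).rootLength (Finset.mem_univ i))

lemma posForm_comm (i j : ι) :
    (P.posRootForm ℤ).posForm (P.rootSpanMem ℤ i) (P.rootSpanMem ℤ j) =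
      (P.posRootForm ℤ).posForm (P.rootSpanMem ℤ j) (P.rootSpanMem ℤ i) :=
  (P.posRootForm ℤ).isSymm_posForm.eq (P.rootSpanMem ℤ i) (P.rootSpanMem ℤ j)

lemma stdForm_symm (i j : ι) : P.stdForm i j = P.stdForm j i := by
  unfold stdForm
  rw [P.longSq_eq i j, P.posForm_comm i j]

lemma exists_longSq_eq [P.IsReduced] [P.IsIrreducible] (i : ι) :
    ∃ k : ℕ, P.longSq i = k * (P.posRootForm ℤ).rootLength i := by
  obtain ⟨j, -, hj⟩ := Finset.exists_mem_eq_sup' ⟨i, Finset.mem_univ i⟩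
    (P.posRootForm ℤ).rootLength
  have hle : (P.posRootForm ℤ).rootLength i ≤ (P.posRootForm ℤ).rootLength j := by
    rw [← hj]; exact Finset.le_sup' _ (Finset.mem_univ i)
  have hpos := (P.posRootForm ℤ).rootLength_pos i
  have hposj := (P.posRootForm ℤ).rootLength_pos j
  change ∃ k : ℕ, (Finset.univ : Finset ι).sup' ⟨i, Finset.mem_univ i⟩
    (P.posRootForm ℤ).rootLength = _
  rw [hj]
  have h := (P.posRootForm ℤ).toInvariantForm.apply_eq_or i j
  simp only [RootPositiveForm.toInvariantForm_form, ← RootPositiveForm.algebraMap_rootLength,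
    algebraMap_int_eq, eq_intCast] at h
  norm_cast at h
  rcases h with h | h | h | h | h
  · exact ⟨1, by simp [h]⟩
  · exact absurd hle (by omega)
  · exact absurd hle (by omega)
  · exact ⟨2, h⟩
  · exact ⟨3, h⟩

lemma lengthRatio_mul [P.IsReduced] [P.IsIrreducible] (i : ι) :
    (P.lengthRatio i : ℚ) * P.stdForm i i = 2 := by
  obtain ⟨k, hk⟩ := P.exists_longSq_eq i
  have hpos : (0 : ℚ) < (P.posRootForm ℤ).rootLength i := by
    exact_mod_cast (P.posRootForm ℤ).rootLength_pos i
  have hlong : (0 : ℚ) < P.longSq i := by exact_mod_cast P.longSq_pos i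
  have hkq : (P.longSq i : ℚ) = k * (P.posRootForm ℤ).rootLength i := by exact_mod_cast hk
  have h1 : 2 / P.stdForm i i = k := by
    rw [stdForm_self, hkq]
    have : (k : ℚ) ≠ 0 := by
      rintro h; rw [hkq, h, zero_mul] at hlong; exact lt_irrefl _ hlong
    field_simp
  have h2 : P.lengthRatio i = k := by
    rw [lengthRatio, h1]; simp
  have h3 : P.stdForm i i ≠ 0 := by
    rw [stdForm_self]; positivity
  rw [h2, ← h1]; field_simp

lemma pairingIn_eq [P.IsReduced] [P.IsIrreducible] (i j : ι) :
    (P.pairingIn ℤ j i : ℚ) = P.lengthRatio i * P.stdForm i j := by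
  have h : 2 * (P.posRootForm ℤ).posForm (P.rootSpanMem ℤ j) (P.rootSpanMem ℤ i)
      = P.pairingIn ℤ j i * (P.posRootForm ℤ).rootLength i := by
    apply FaithfulSMul.algebraMap_injective ℤ ℂ
    have := (P.posRootForm ℤ).two_mul_apply_root_root j i
    rw [map_mul, map_mul, RootPositiveForm.algebraMap_posForm, algebraMap_pairingIn,
      RootPositiveForm.algebraMap_rootLength]
    simpa using this
  rw [P.posForm_comm j i] at h
  have hq : 2 * (((P.posRootForm ℤ).posForm (P.rootSpanMem ℤ i) (P.rootSpanMem ℤ j) : ℤ) : ℚ)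
      = P.pairingIn ℤ j i * (P.posRootForm ℤ).rootLength i := by exact_mod_cast h
  have h3 := P.lengthRatio_mul i
  rw [stdForm_self] at h3
  rw [stdForm, hq]
  linear_combination (-(P.pairingIn ℤ j i : ℚ) / 2) * h3

/-- The Cartan data of an irreducible reduced crystallographic root system with respect to a base.
The Cartan matrix is `C_ab = 2 (α_a|α_b) / (α_a|α_a)`. -/
def Base.cartanData {P : RootPairing ι ℂ M N} [P.IsCrystallographic] [P.IsReduced]
    [P.IsIrreducible] (b : P.Base) : CartanData b.support where
  gram i j := P.stdForm i j
  t i := P.lengthRatio i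
  cartan i j := b.cartanMatrix j i
  gram_symm i j := P.stdForm_symm i j
  t_mul_gram_self i := P.lengthRatio_mul i
  cartan_eq i j := P.pairingIn_eq i j
  gram_pos z hz := by
    obtain ⟨i0, -⟩ := Function.ne_iff.mp hz
    set v : P.rootSpan ℤ := ∑ i, z i • P.rootSpanMem ℤ (i : ι) with hv
    have hv0 : v ≠ 0 := by
      intro h0
      apply hz
      funext i
      exact Fintype.linearIndependent_iff.mp b.linearIndependentInt z (by rw [← h0]) i
    have hpos := P.posRootForm_posForm_pos_of_ne_zero ℤ hv0
    have hlong : (0 : ℚ) < P.longSq i0 := by exact_mod_cast P.longSq_pos (i0 : ι)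
    have hexp : ∑ i : b.support, ∑ j : b.support, (z i : ℚ) * P.stdForm i j * z j
        = 2 / P.longSq i0 * ((P.posRootForm ℤ).posForm v v : ℤ) := by
      rw [hv]
      simp only [map_sum, LinearMap.sum_apply, map_smul, LinearMap.smul_apply, smul_eq_mul]
      push_cast
      rw [Finset.sum_comm, Finset.mul_sum]
      refine Finset.sum_congr rfl fun i _ => ?_
      rw [Finset.mul_sum, Finset.mul_sum]
      refine Finset.sum_congr rfl fun j _ => ?_
      rw [stdForm, P.longSq_eq j i0]
      ring
    rw [hexp]
    have : (0 : ℚ) < ((P.posRootForm ℤ).posForm v v : ℤ) := by exact_mod_cast hpos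
    positivity

end RootPairing

/-! Put `v_m^{(a)} = y_a^m ∏ (Q_k^{(b)})^{-(α_a|α_b)B_{am,bk}}`. Dividing the `Q`-system by `Q_m²`
turns it into `1 - v_m = Q_{m+1} Q_{m-1} / Q_m²`, a second difference in `m` written
multiplicatively. The kernel `-min(m,k)` inverts second differences, and convergence removes the
remaining linear freedom, so the conditions are equivalent to `Q_m^{(a)} = ∏_k (1 -
v_k^{(a)})^{-min(m,k)}` (`IsQSystem.isProductForm`, `IsProductForm.isQSystem`). Since `v_k` carries
the factor `y_a^k`, this is a contracting fixed-point equation for the order filtration, which gives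
existence and uniqueness.

Inserting the product formula into `v` gives `v_i = y_a^m ∏_j (1 - v_j)^{G_ij}` with `i = (a,m)`, `j
= (b,k)` and `G_ij = (α_a|α_b) min(t_b m, t_a k)`. Modulo order `l + 1` only the indices `m, k ≤ l`
matter; the truncation error is absorbed by replacing `y_a^m` with a series `w_i` congruent to it.
Lagrange–Good inversion (`subst_binomialProdSeries_mul_det`) then evaluates the binomial sum at `w`
as the inverse of `det(δ_ij (1 - v_j) + G_ij v_j)`.

It remains to see that this determinant is also inverse to the Jacobian of the `Q_1^{(a)} = ∏_k (1 -
v_k^{(a)})^{-1}`. With `Z = diag(v_j/(1 - v_j))`, logarithmic differentiation expresses the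
derivatives of `v` through `(1 + GZ)^{-1}`. The identity `det(1 - AB) = det(1 - BA)` combines the
two determinants into `det(1 + (G - H)Z)`, where `H_ij = C_ba m`. But `G_ij = C_ba m` as soon as
`t_b m ≤ t_a k`, so this matrix is unitriangular for the ordering by `m / t_a` and the product is
`1` (`IsProductForm.mk_det_jacobianMatrix_levelQ_mul`). Letting `l` grow gives an identity in
`ℂ[[y]]`, and rescaling rows and columns by monomials transfers it to `x`. -/

namespace Derivation

/-! ### Logarithmic derivatives of units. -/

/-- The logarithmic derivative `u ↦ u⁻¹ D u` on units. -/
def unitsLog {R A : Type*} [CommRing R] [CommRing A] [Algebra R A] (D : Derivation R A A) :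
    Additive Aˣ →+ A :=
  AddMonoidHom.mk' (fun u => ↑(u.toMul⁻¹) * D ↑u.toMul) fun u v => by
    simp only [toMul_add, mul_inv, Units.val_mul, leibniz, smul_eq_mul]
    have hu := u.toMul.inv_mul
    have hv := v.toMul.inv_mul
    linear_combination (↑(v.toMul⁻¹) * D ↑v.toMul) * hu + (↑(u.toMul⁻¹) * D ↑u.toMul) * hv

lemma apply_unit {R A : Type*} [CommRing R] [CommRing A] [Algebra R A] (D : Derivation R A A)
    (u : Aˣ) : D (u : A) = u * D.unitsLog (Additive.ofMul u) := by
  change _ = (u : A) * (↑(u⁻¹) * D ↑u)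
  rw [← mul_assoc, u.mul_inv, one_mul]

lemma apply_unit_zpow {R A : Type*} [CommRing R] [CommRing A] [Algebra R A]
    (D : Derivation R A A) (u : Aˣ) (z : ℤ) :
    D ((u ^ z : Aˣ) : A) = z * ((u ^ (z - 1) : Aˣ) : A) * D u := by
  rw [apply_unit, ofMul_zpow, map_zsmul, apply_unit D u, zpow_sub_one, zsmul_eq_mul]
  rw [Units.val_mul]
  have hu := u.inv_mul
  linear_combination (-(z : A) * ((u ^ z : Aˣ) : A) * D.unitsLog (Additive.ofMul u)) * hu

end Derivation

/-! ### Integer powers of `1 - X` in one variable. -/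

namespace PowerSeries

/-- The unit `1 - X`. -/
def oneSubX (K : Type*) [CommRing K] : (PowerSeries K)ˣ where
  val := 1 - X
  inv := mk 1
  val_inv := by rw [mul_comm]; exact mk_one_mul_one_sub_eq_one K
  inv_val := mk_one_mul_one_sub_eq_one K

/-- By Pascal's rule, multiplication by `1 - X` lowers `p` by one. Starting from the geometric
series at `p = 0`, induction in both directions reaches every integer. -/
lemma mk_choose_eq_oneSubX_zpow (K : Type*) [CommRing K] (p : ℤ) :
    (mk fun n => ((Ring.choose (p + n) n : ℤ) : K)) = ((oneSubX K ^ (-p - 1) : (PowerSeries K)ˣ) :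
      PowerSeries K) := by
  have key : ∀ p : ℤ, (1 - X) * (mk fun n => ((Ring.choose (p + n) n : ℤ) : K)) =
      mk fun n => ((Ring.choose (p - 1 + n) n : ℤ) : K) := by
    intro p
    ext n
    rcases n with _ | n
    · simp [sub_mul]
    · rw [sub_mul, one_mul, map_sub, coeff_succ_X_mul, coeff_mk, coeff_mk, coeff_mk,
        ← Int.cast_sub]
      congr 1
      have := Ring.choose_succ_succ (p + n) n
      push_cast at this ⊢
      rw [show p + (↑n + 1) = p + n + 1 by ring, this,
        show p - 1 + (↑n + 1) = p + n by ring]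
      ring
  have hval : ((oneSubX K : (PowerSeries K)ˣ) : PowerSeries K) = 1 - X := rfl
  induction p using Int.induction_on with
  | zero =>
    have : ((oneSubX K ^ (-0 - 1 : ℤ) : (PowerSeries K)ˣ) : PowerSeries K) = mk 1 := by
      simp; rfl
    rw [this]
    ext n
    simp only [coeff_mk, zero_add]
    have := Ring.choose_natCast (R := ℤ) n n
    simp only [Nat.choose_self, Nat.cast_one] at this
    rw [this]; simp
  | succ i ih =>
    have h := key (i + 1)
    rw [add_sub_cancel_right, ih, ← hval] at h
    rw [show -((i : ℤ) + 1) - 1 = -1 + (-i - 1) by ring, zpow_add, zpow_neg_one, Units.val_mul, ← h,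
      Units.inv_mul_cancel_left]
  | pred i ih =>
    rw [← key, ih, ← hval, ← Units.val_mul, ← zpow_one_add]
    congr 2; ring

lemma coeff_oneSubX_zpow (K : Type*) [CommRing K] (p : ℤ) (n : ℕ) :
    coeff n ((oneSubX K ^ (-p - 1) : (PowerSeries K)ˣ) : PowerSeries K) =
      ((Ring.choose (p + n) n : ℤ) : K) := by
  rw [← mk_choose_eq_oneSubX_zpow, coeff_mk]

/-- This is `X d/dX` applied to `(1 - X)^A`. It supplies the linear relation that makes the
coefficient determinants in Good's formula vanish. -/
lemma natCast_mul_coeff_oneSubX_zpow (K : Type*) [CommRing K] (A : ℤ) (n : ℕ) :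
    (n : K) * coeff n ((oneSubX K ^ A : (PowerSeries K)ˣ) : PowerSeries K) =
      -A * coeff n (X * ((oneSubX K ^ (A - 1) : (PowerSeries K)ˣ) : PowerSeries K)) := by
  rcases n with _ | n
  · simp
  · have h := congrArg (coeff n) ((derivative K).apply_unit_zpow (oneSubX K) A)
    have hval : ((oneSubX K : (PowerSeries K)ˣ) : PowerSeries K) = 1 - X := rfl
    rw [coeff_derivative, hval, map_sub, derivative_one, derivative_X, zero_sub,
      mul_neg_one, mul_comm] at h
    rw [coeff_succ_X_mul]
    push_cast
    rw [h, ← map_intCast (C (R := K)), map_neg, coeff_C_mul]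
    ring

end PowerSeries

/-! ### Products and determinants of series in separated variables. -/

namespace MvPowerSeries

/-- The inclusion of `K[[X]]` in `K[[X_i : i ∈ σ]]` with image `K[[X_j]]`. -/
def ofVar {σ : Type*} (K : Type*) [CommRing K] (j : σ) :
    PowerSeries K →+* MvPowerSeries σ K :=
  (rename (R := K) (⟨fun _ => j, fun _ _ _ => rfl⟩ : Unit ↪ σ)).toRingHom

lemma ofVar_X {σ K : Type*} [CommRing K] (j : σ) :
    ofVar K j PowerSeries.X = X j :=
  rename_X _ _

lemma coeff_ofVar_single {σ K : Type*} [CommRing K] (j : σ) (f : PowerSeries K) (k : ℕ) :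
    coeff (Finsupp.single j k) (ofVar K j f) = PowerSeries.coeff k f := by
  have := coeff_embDomain_rename (R := K) (⟨fun _ => j, fun _ _ _ => rfl⟩ : Unit ↪ σ) f
    (Finsupp.single () k)
  rw [Finsupp.embDomain_single] at this
  exact this

lemma eq_single_of_coeff_ofVar_ne_zero {σ K : Type*} [CommRing K] (j : σ) (f : PowerSeries K)
    (d : σ →₀ ℕ) (h : coeff d (ofVar K j f) ≠ 0) : ∃ k, d = Finsupp.single j k := by
  by_contra hd
  refine h (coeff_rename_eq_zero _ _ ?_)
  rintro ⟨x, rfl⟩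
  refine hd ⟨x (), ?_⟩
  have hx : x = Finsupp.single () (x ()) := by ext; simp
  rw [hx, Finsupp.mapDomain_single]
  simp only [Finsupp.single_eq_same]
  rfl

lemma coeff_prod_ofVar_aux {σ K : Type*} [CommRing K] [DecidableEq σ]
    (f : σ → PowerSeries K) (s : Finset σ) (d : σ →₀ ℕ) :
    coeff d (∏ j ∈ s, ofVar K j (f j)) =
      if d.support ⊆ s then ∏ j ∈ s, PowerSeries.coeff (d j) (f j) else 0 := by
  induction s using Finset.induction_on generalizing d with
  | empty => simp [coeff_one]
  | insert a s ha ih =>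
    rw [Finset.prod_insert ha, coeff_mul,
      -- The factor for `a` involves only the variable `a` and the others do not involve it, so a
      -- single splitting of the exponent survives.
      Finset.sum_eq_single (Finsupp.single a (d a), d.erase a)]
    · simp only
      rw [coeff_ofVar_single, ih, Finset.prod_insert ha, mul_ite, mul_zero,
        Finsupp.support_erase]
      refine if_congr Finset.subset_insert_iff.symm ?_ rfl
      congr 1
      refine Finset.prod_congr rfl fun j hj => ?_
      rw [Finsupp.erase_ne (by rintro rfl; exact ha hj)]
    · rintro ⟨p, q⟩ hpq hne
      rw [Finset.HasAntidiagonal.mem_antidiagonal] at hpq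
      by_contra h
      obtain ⟨k, hk⟩ := eq_single_of_coeff_ofVar_ne_zero a _ _ (left_ne_zero_of_mul h)
      have h2 := right_ne_zero_of_mul h
      rw [ih] at h2
      have hq : q a = 0 := by
        by_contra hqa
        exact ha ((ite_ne_right_iff.mp h2).1 (Finsupp.mem_support_iff.mpr hqa))
      simp only at hpq hk
      subst hpq hk
      refine hne (Prod.ext ?_ ?_)
      · simp [hq]
      · ext j
        by_cases hj : j = a
        · subst hj; simp [hq]
        · simp [Finsupp.erase_ne hj]
    · intro h
      exact absurd (Finset.HasAntidiagonal.mem_antidiagonal.mpr (Finsupp.single_add_erase a d)) h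

lemma coeff_prod_ofVar {σ K : Type*} [CommRing K] [Fintype σ]
    (f : σ → PowerSeries K) (d : σ →₀ ℕ) :
    coeff d (∏ j, ofVar K j (f j)) = ∏ j, PowerSeries.coeff (d j) (f j) := by
  classical
  rw [coeff_prod_ofVar_aux, if_pos (Finset.subset_univ _)]

/-- Column `j` involves only the variable `j`, so each Leibniz term is a product of series in
distinct variables and coefficients can be extracted column by column. -/
lemma coeff_det_ofVar {σ K : Type*} [CommRing K] [Fintype σ] [DecidableEq σ]
    (f : σ → σ → PowerSeries K) (d : σ →₀ ℕ) :
    coeff d (Matrix.of fun i j => ofVar K j (f i j)).det =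
      (Matrix.of fun i j => PowerSeries.coeff (d j) (f i j)).det := by
  simp only [Matrix.det_apply, map_sum, Matrix.of_apply]
  refine Finset.sum_congr rfl fun s _ => ?_
  rw [← coeff_prod_ofVar]
  simp only [Units.smul_def, map_zsmul]

/-- A series over finitely many variables is its constant term plus a combination of the
variables. -/
lemma exists_eq_C_add_sum_X_mul {σ K : Type*} [CommRing K] [Fintype σ] (g : MvPowerSeries σ K) :
    ∃ h : σ → MvPowerSeries σ K, g = C (constantCoeff g) + ∑ i, X i * h i := by
  classical
  -- Each nonconstant monomial is assigned to one variable that divides it, so that it is counted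
  -- exactly once; `none` is reserved for the constant monomial.
  have hex : ∀ d : σ →₀ ℕ, ∃ i : Option σ, (∀ j, i = some j → d j ≠ 0) ∧ (d ≠ 0 → i ≠ none) := by
    intro d
    by_cases hd : d = 0
    · exact ⟨none, by simp, by simp [hd]⟩
    · obtain ⟨i, hi⟩ := Finsupp.ne_iff.mp hd
      exact ⟨some i, by rintro j ⟨⟩; simpa using hi, by simp⟩
  choose c hc1 hc2 using hex
  let h : σ → MvPowerSeries σ K := fun i d => if c (d + Finsupp.single i 1) = some i then
    coeff (d + Finsupp.single i 1) g else 0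
  refine ⟨h, ?_⟩
  ext d
  have hX : ∀ i, coeff d (X i * h i) = if c d = some i then coeff d g else 0 := by
    intro i
    by_cases hi : d i = 0
    · rw [if_neg (fun h => hc1 d i h hi), X_def, coeff_monomial_mul, if_neg]
      intro hle
      have := hle i
      simp [hi] at this
    · obtain ⟨e, rfl⟩ : ∃ e, d = e + Finsupp.single i 1 := by
        refine ⟨d - Finsupp.single i 1, ?_⟩
        rw [tsub_add_cancel_of_le]
        rw [Finsupp.single_le_iff]; omega
      rw [X_def, add_comm, coeff_add_monomial_mul, one_mul, add_comm]
      rfl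
  rw [map_add, map_sum, Finset.sum_congr rfl fun i _ => hX i, coeff_C]
  by_cases hd : d = 0
  · subst hd
    have : c 0 = none := by
      rcases h : c 0 with _ | j
      · rfl
      · exact absurd rfl (hc1 0 j h)
    simp [this]
  · rw [if_neg hd, zero_add]
    obtain ⟨i, hi⟩ := Option.ne_none_iff_exists'.mp (hc2 d hd)
    simp [hi]

end MvPowerSeries

lemma Finset.prod_zpow_eq_zpow_sum {ι α : Type*} [CommGroup α] (s : Finset ι) (f : ι → ℤ) (x : α) :
    ∏ i ∈ s, x ^ f i = x ^ ∑ i ∈ s, f i := by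
  classical
  induction s using Finset.induction_on with
  | empty => simp
  | insert a s ha ih => rw [prod_insert ha, sum_insert ha, ih, zpow_add]

/-! ### The order filtration and Lagrange–Good inversion. -/

namespace MvPowerSeries

/-- The ideal of power series of order at least `n`. -/
def orderIdeal (σ R : Type*) [CommRing R] (n : ℕ) : Ideal (MvPowerSeries σ R) where
  carrier := {f | ∀ d : σ →₀ ℕ, d.degree < n → coeff d f = 0}
  zero_mem' d _ := by simp
  add_mem' hf hg d hd := by rw [map_add, hf d hd, hg d hd, add_zero]
  smul_mem' c f hf d hd := by
    classical
    rw [smul_eq_mul, coeff_mul]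
    refine Finset.sum_eq_zero fun p hp => ?_
    rw [hf p.2, mul_zero]
    have := Finset.HasAntidiagonal.mem_antidiagonal.mp hp
    rw [← this, map_add] at hd
    omega

lemma mem_orderIdeal {σ R : Type*} [CommRing R] {n : ℕ} {f : MvPowerSeries σ R} :
    f ∈ orderIdeal σ R n ↔ ∀ d : σ →₀ ℕ, d.degree < n → coeff d f = 0 := Iff.rfl

lemma mul_mem_orderIdeal {σ R : Type*} [CommRing R] {m n : ℕ} {f g : MvPowerSeries σ R}
    (hf : f ∈ orderIdeal σ R m) (hg : g ∈ orderIdeal σ R n) : f * g ∈ orderIdeal σ R (m + n) := by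
  classical
  intro d hd
  rw [coeff_mul]
  refine Finset.sum_eq_zero fun p hp => ?_
  have := Finset.HasAntidiagonal.mem_antidiagonal.mp hp
  rw [← this, map_add] at hd
  by_cases h : p.1.degree < m
  · rw [hf _ h, zero_mul]
  · rw [hg _ (by omega), mul_zero]

lemma orderIdeal_anti {σ R : Type*} [CommRing R] {m n : ℕ} (h : m ≤ n) :
    orderIdeal σ R n ≤ orderIdeal σ R m := fun _ hf d hd => hf d (hd.trans_le h)

lemma eq_zero_of_forall_mem_orderIdeal {σ R : Type*} [CommRing R] {f : MvPowerSeries σ R}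
    (h : ∀ n, f ∈ orderIdeal σ R n) : f = 0 := by
  ext d
  exact h (d.degree + 1) d (Nat.lt_succ_self _)

lemma mem_orderIdeal_one {σ R : Type*} [CommRing R] {f : MvPowerSeries σ R}
    (h : constantCoeff f = 0) : f ∈ orderIdeal σ R 1 := by
  intro d hd
  have : d = 0 := by rw [← Finsupp.degree_eq_zero_iff]; omega
  rw [this]; exact h

lemma X_mem_orderIdeal_one {σ R : Type*} [CommRing R] (i : σ) :
    (X i : MvPowerSeries σ R) ∈ orderIdeal σ R 1 := mem_orderIdeal_one (constantCoeff_X i)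

lemma X_pow_mem_orderIdeal {σ R : Type*} [CommRing R] (i : σ) (n : ℕ) :
    (X i : MvPowerSeries σ R) ^ n ∈ orderIdeal σ R n := by
  induction n with
  | zero => intro d hd; omega
  | succ n ih => rw [pow_succ]; exact mul_mem_orderIdeal ih (X_mem_orderIdeal_one i)

/-- The linear map sending `g` to `∑_d w^d [u^d] (g φ^d)`. -/
def diagCoeff {σ K : Type*} [CommRing K] [Fintype σ] (φ : σ → MvPowerSeries σ K) :
    MvPowerSeries σ K →ₗ[K] MvPowerSeries σ K where
  toFun g := fun d => coeff d (g * ∏ i, φ i ^ d i)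
  map_add' f g := by
    ext d
    change coeff d ((f + g) * _) = coeff d (f * _) + coeff d (g * _)
    rw [add_mul, map_add]
  map_smul' r g := by
    ext d
    change coeff d ((r • g) * _) = r * coeff d (g * _)
    rw [smul_mul_assoc, coeff_smul]

lemma coeff_diagCoeff {σ K : Type*} [CommRing K] [Fintype σ] (φ : σ → MvPowerSeries σ K)
    (g : MvPowerSeries σ K) (d : σ →₀ ℕ) :
    coeff d (diagCoeff φ g) = coeff d (g * ∏ i, φ i ^ d i) := rfl

/-- Lowering the exponent `d i` by one to cancel `X i` leaves one extra factor `φ i` from `φ^d`.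
This mirrors the functional equation `v_i = w_i φ_i(v)`. -/
lemma diagCoeff_X_mul {σ K : Type*} [CommRing K] [Fintype σ] (φ : σ → MvPowerSeries σ K)
    (i : σ) (g : MvPowerSeries σ K) :
    diagCoeff φ (X i * g) = X i * diagCoeff φ (φ i * g) := by
  classical
  ext d
  rw [coeff_diagCoeff, mul_assoc]
  by_cases hi : d i = 0
  · have hle : ¬ Finsupp.single i 1 ≤ d := by
      rw [Finsupp.single_le_iff]; omega
    rw [X_def, coeff_monomial_mul, coeff_monomial_mul, if_neg hle, if_neg hle]
  · obtain ⟨e, rfl⟩ : ∃ e, d = Finsupp.single i 1 + e := by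
      refine ⟨d - Finsupp.single i 1, ?_⟩
      rw [add_tsub_cancel_of_le]
      rw [Finsupp.single_le_iff]; omega
    rw [X_def, coeff_add_monomial_mul, coeff_add_monomial_mul, coeff_diagCoeff]
    congr 2
    simp only [Finsupp.add_apply, pow_add, Finset.prod_mul_distrib]
    rw [Finset.prod_eq_single i (fun j _ hj => by rw [Finsupp.single_eq_of_ne hj, pow_zero])
      (by simp), Finsupp.single_eq_same, pow_one]
    ring

/-- **Lagrange–Good inversion**: the coefficients of `g(v(w))`, where `v_i = w_i φ_i(v)`. -/
theorem subst_diagCoeff_mul {σ τ K : Type*} [CommRing K] [Fintype σ]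
    (φ : σ → MvPowerSeries σ K) (J : MvPowerSeries σ K) (hJ : diagCoeff φ J = 1)
    (v w : σ → MvPowerSeries τ K) (hv : HasSubst v) (hw : HasSubst w)
    (hw0 : ∀ i, constantCoeff (w i) = 0) (h : ∀ i, v i = w i * subst v (φ i))
    (g : MvPowerSeries σ K) : subst w (diagCoeff φ (g * J)) = subst v g := by
  -- Both sides are linear in `g`, send `1` to `1`, and send `X_i f` to `w_i` times the value at
  -- `φ_i f`. Splitting off the constant term of `g` therefore expresses the difference as a
  -- combination of the `w_i`, which gains one order at each step.
  have key : ∀ n, ∀ g, subst w (diagCoeff φ (g * J)) - subst v g ∈ orderIdeal τ K n := by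
    intro n
    induction n with
    | zero => intro g d hd; omega
    | succ n ih =>
      intro g
      obtain ⟨f, hf⟩ := exists_eq_C_add_sum_X_mul g
      have hC : C (constantCoeff g) * J = constantCoeff g • J := by rw [smul_eq_C_mul]
      have e : subst w (diagCoeff φ (g * J)) - subst v g =
          ∑ i, w i * (subst w (diagCoeff φ (φ i * f i * J)) - subst v (φ i * f i)) := by
        conv_lhs => rw [hf]
        rw [add_mul, hC, map_add, map_smul, hJ, Finset.sum_mul, map_sum]
        simp only [mul_assoc, diagCoeff_X_mul]
        rw [← coe_substAlgHom hw, ← coe_substAlgHom hv] at *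
        simp only [map_add, map_sum, map_mul, map_smul, map_one, mul_sub, Finset.sum_sub_distrib]
        simp only [substAlgHom_X] at *
        have h1 : (substAlgHom hv) (C (constantCoeff g)) = constantCoeff g • 1 := by
          rw [← mul_one (C _), ← smul_eq_C_mul, map_smul, map_one]
        rw [h1, add_sub_add_left_eq_sub]
        congr 1
        refine Finset.sum_congr rfl fun i _ => ?_
        rw [← mul_assoc, ← h i]
      rw [e]
      refine Ideal.sum_mem _ fun i _ => ?_
      rw [add_comm]
      exact mul_mem_orderIdeal (mem_orderIdeal_one (hw0 i)) (ih _)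
  exact sub_eq_zero.mp (eq_zero_of_forall_mem_orderIdeal fun n => key n g)

/-- The unit `1 - X_i`. -/
def oneSubVar {σ : Type*} (K : Type*) [CommRing K] (i : σ) : (MvPowerSeries σ K)ˣ :=
  Units.map (ofVar K i).toMonoidHom (PowerSeries.oneSubX K)

lemma coe_oneSubVar {σ K : Type*} [CommRing K] (i : σ) :
    (oneSubVar K i : MvPowerSeries σ K) = 1 - X i := by
  change ofVar K i (1 - PowerSeries.X) = _
  rw [map_sub, map_one, ofVar_X]

lemma coe_oneSubVar_zpow {σ K : Type*} [CommRing K] (i : σ) (z : ℤ) :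
    ((oneSubVar K i ^ z : (MvPowerSeries σ K)ˣ) : MvPowerSeries σ K) =
      ofVar K i ((PowerSeries.oneSubX K ^ z : (PowerSeries K)ˣ) : PowerSeries K) := by
  rw [oneSubVar, ← map_zpow]; rfl

/-- The unit `∏_j (1 - X_j)^{G_ij}`. -/
def oneSubVarProd {σ : Type*} (K : Type*) [CommRing K] [Fintype σ] (G : σ → σ → ℤ) (i : σ) :
    (MvPowerSeries σ K)ˣ := ∏ j, oneSubVar K j ^ G i j

lemma prod_oneSubVarProd_pow {σ K : Type*} [CommRing K] [Fintype σ] (G : σ → σ → ℤ) (d : σ → ℕ) :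
    ∏ i, (oneSubVarProd K G i : MvPowerSeries σ K) ^ d i =
      ((∏ j, oneSubVar K j ^ (∑ i, d i * G i j) : (MvPowerSeries σ K)ˣ) : MvPowerSeries σ K) := by
  simp only [← Units.val_pow_eq_pow_val, ← Units.coe_prod]
  congr 1
  simp only [oneSubVarProd, ← Finset.prod_pow]
  rw [Finset.prod_comm]
  refine Finset.prod_congr rfl fun j _ => ?_
  rw [← Finset.prod_zpow_eq_zpow_sum]
  refine Finset.prod_congr rfl fun i _ => ?_
  rw [mul_comm, zpow_mul, zpow_natCast]

/-- The Jacobian `det (δ_ij + G_ij X_j / (1 - X_j))`. -/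
def goodJacobian {σ : Type*} (K : Type*) [CommRing K] [Fintype σ] [DecidableEq σ]
    (G : σ → σ → ℤ) : MvPowerSeries σ K :=
  (Matrix.of fun i j => ofVar K j ((if i = j then 1 else 0) +
    (G i j : PowerSeries K) * (PowerSeries.X *
          (((PowerSeries.oneSubX K)⁻¹ : (PowerSeries K)ˣ) : PowerSeries K)))).det

lemma goodJacobian_mul {σ K : Type*} [CommRing K] [Fintype σ] [DecidableEq σ]
    (G : σ → σ → ℤ) (f : σ → PowerSeries K) :
    goodJacobian K G * ∏ j, ofVar K j (f j) = (Matrix.of fun i j => ofVar K j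
      ((if i = j then f j else 0) +
        (G i j : PowerSeries K) * (PowerSeries.X *
          (((PowerSeries.oneSubX K)⁻¹ : (PowerSeries K)ˣ) : PowerSeries K) * f j))).det := by
  rw [mul_comm, goodJacobian, ← Matrix.det_mul_row]
  congr 1
  ext i j : 1
  simp only [Matrix.of_apply]
  rw [← map_mul]
  congr 1
  split_ifs <;> ring

/-- The Jacobian is the normalization required by the inversion theorem. Each coefficient becomes a
determinant of one-variable coefficients: the identity matrix at exponent `0`, and singular at every
other exponent. -/
lemma diagCoeff_goodJacobian {σ K : Type*} [CommRing K] [IsDomain K] [CharZero K] [Fintype σ]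
    [DecidableEq σ] (G : σ → σ → ℤ) :
    diagCoeff (fun i => (oneSubVarProd K G i : MvPowerSeries σ K)) (goodJacobian K G) = 1 := by
  ext d
  rw [coeff_diagCoeff, prod_oneSubVarProd_pow, Units.coe_prod]
  simp only [coe_oneSubVar_zpow]
  rw [goodJacobian_mul, coeff_det_ofVar, coeff_one]
  obtain ⟨A, hA⟩ : ∃ A : σ → ℤ, ∀ j, ∑ i, d i * G i j = A j := ⟨_, fun _ => rfl⟩
  simp only [hA]
  have hent : ∀ i j, PowerSeries.coeff (d j) ((if i = j then
      ((PowerSeries.oneSubX K ^ A j : (PowerSeries K)ˣ) : PowerSeries K) else 0) +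
        (G i j : PowerSeries K) * (PowerSeries.X *
          (((PowerSeries.oneSubX K)⁻¹ : (PowerSeries K)ˣ) : PowerSeries K) *
          ((PowerSeries.oneSubX K ^ A j : (PowerSeries K)ˣ) : PowerSeries K))) =
      (if i = j then PowerSeries.coeff (d j)
        ((PowerSeries.oneSubX K ^ A j : (PowerSeries K)ˣ) : PowerSeries K) else 0) +
      G i j * PowerSeries.coeff (d j) (PowerSeries.X *
          ((PowerSeries.oneSubX K ^ (A j - 1) : (PowerSeries K)ˣ) : PowerSeries K)) := by
    intro i j
    rw [map_add, ← map_intCast (PowerSeries.C (R := K)), PowerSeries.coeff_C_mul, zpow_sub_one,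
      mul_assoc PowerSeries.X, ← Units.val_mul, mul_comm (PowerSeries.oneSubX K)⁻¹]
    split_ifs <;> simp
  split_ifs with hd
  · subst hd
    have : (Matrix.of fun i j => PowerSeries.coeff ((0 : σ →₀ ℕ) j) ((if i = j then
      ((PowerSeries.oneSubX K ^ A j : (PowerSeries K)ˣ) : PowerSeries K) else 0) +
        (G i j : PowerSeries K) * (PowerSeries.X *
          (((PowerSeries.oneSubX K)⁻¹ : (PowerSeries K)ˣ) : PowerSeries K) *
          ((PowerSeries.oneSubX K ^ A j : (PowerSeries K)ˣ) : PowerSeries K)))) = 1 := by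
      ext i j
      rw [Matrix.of_apply, hent, Matrix.one_apply]
      simp [← hA]
    rw [this, Matrix.det_one]
  · rw [← Matrix.exists_vecMul_eq_zero_iff]
    -- The exponent vector is a left null vector: since `∑_i d_i G_ij = A_j`, column `j` reduces to
    -- the Euler relation for `(1 - X)^{A_j}`. Characteristic zero keeps this vector nonzero.
    refine ⟨fun i => (d i : K), ?_, ?_⟩
    · obtain ⟨i, hi⟩ := Finsupp.ne_iff.mp hd
      exact Function.ne_iff.mpr ⟨i, by simpa using hi⟩
    · ext j
      simp only [Matrix.vecMul, dotProduct, Matrix.of_apply, hent, mul_add, mul_ite, mul_zero,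
        Finset.sum_add_distrib, Finset.sum_ite_eq', Finset.mem_univ, if_true, Pi.zero_apply]
      rw [PowerSeries.natCast_mul_coeff_oneSubX_zpow]
      simp only [← mul_assoc]
      rw [← Finset.sum_mul, ← hA]
      push_cast
      ring

lemma isUnit_goodJacobian {σ K : Type*} [CommRing K] [Fintype σ] [DecidableEq σ]
    (G : σ → σ → ℤ) : IsUnit (goodJacobian K G) := by
  rw [isUnit_iff_constantCoeff, ← coeff_zero_eq_constantCoeff_apply, goodJacobian,
    coeff_det_ofVar]
  have : (Matrix.of fun i j => PowerSeries.coeff ((0 : σ →₀ ℕ) j) ((if i = j then 1 else 0) +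
    (G i j : PowerSeries K) * (PowerSeries.X *
          (((PowerSeries.oneSubX K)⁻¹ : (PowerSeries K)ˣ) : PowerSeries K)))) = 1 := by
    ext i j
    rw [Matrix.of_apply, Matrix.one_apply]
    split_ifs <;> simp
  rw [this, Matrix.det_one]
  exact isUnit_one

/-- The series `∑_d ∏_j binom(P_j + d_j, d_j) X^d` with `P_j = -∑_i d_i G_ij`. -/
def binomialProdSeries {σ : Type*} (K : Type*) [CommRing K] [Fintype σ] (G : σ → σ → ℤ) :
    MvPowerSeries σ K :=
  fun d => ∏ j, ((Ring.choose (-(∑ i, d i * G i j) + d j) (d j) : ℤ) : K)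

lemma diagCoeff_prod_oneSubVar_inv {σ K : Type*} [CommRing K] [Fintype σ] (G : σ → σ → ℤ) :
    diagCoeff (fun i => (oneSubVarProd K G i : MvPowerSeries σ K))
      ((∏ j, (oneSubVar K j)⁻¹ : (MvPowerSeries σ K)ˣ) : MvPowerSeries σ K) =
      binomialProdSeries K G := by
  ext d
  rw [coeff_diagCoeff, prod_oneSubVarProd_pow, ← Units.val_mul, ← Finset.prod_mul_distrib]
  have h : ∀ j, (oneSubVar K j)⁻¹ * oneSubVar K j ^ (∑ i, d i * G i j) =
      oneSubVar K j ^ (-(-(∑ i, d i * G i j)) - 1) := by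
    intro j
    rw [neg_neg, zpow_sub_one, mul_comm]
  simp only [h]
  rw [Units.coe_prod]
  simp only [coe_oneSubVar_zpow]
  rw [coeff_prod_ofVar]
  simp only [PowerSeries.coeff_oneSubX_zpow]
  rfl

/-- Lagrange–Good inversion for `v_i = w_i ∏_j (1 - v_j)^{G_ij}`. -/
theorem subst_binomialProdSeries_mul_det {σ τ K : Type*} [CommRing K] [IsDomain K] [CharZero K]
    [Fintype σ] [DecidableEq σ] (G : σ → σ → ℤ) (v w : σ → MvPowerSeries τ K)
    (o : σ → (MvPowerSeries τ K)ˣ) (ho : ∀ j, (o j : MvPowerSeries τ K) = 1 - v j)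
    (hw0 : ∀ i, constantCoeff (w i) = 0)
    (h : ∀ i, v i = w i * ((∏ j, o j ^ G i j : (MvPowerSeries τ K)ˣ) : MvPowerSeries τ K)) :
    subst w (binomialProdSeries K G) *
      (Matrix.of fun i j => (if i = j then (o j : MvPowerSeries τ K) else 0) + G i j * v j).det
      = 1 := by
  have hv0 : ∀ i, constantCoeff (v i) = 0 := fun i => by rw [h, map_mul, hw0, zero_mul]
  have hv := hasSubst_of_constantCoeff_zero hv0
  have hw := hasSubst_of_constantCoeff_zero hw0
  have hmap : ∀ j, Units.map (substAlgHom (R := K) hv).toMonoidHom (oneSubVar K j) = o j := by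
    intro j
    ext1
    rw [ho]
    change substAlgHom hv (oneSubVar K j : MvPowerSeries σ K) = _
    rw [coe_oneSubVar, map_sub, map_one, substAlgHom_X]
  obtain ⟨J', hJ'⟩ := (isUnit_goodJacobian (K := K) G).exists_left_inv
  set U : (MvPowerSeries σ K)ˣ := ∏ j, oneSubVar K j with hU
  -- The test series is the inverse of Jacobian times `∏ (1 - X_j)`, chosen so that the inversion
  -- theorem sees `∏ (1 - X_j)^{-1}`, whose diagonal coefficients are the binomial products.
  have hg : J' * ((U⁻¹ : (MvPowerSeries σ K)ˣ) : MvPowerSeries σ K) * goodJacobian K G =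
      ((∏ j, (oneSubVar K j)⁻¹ : (MvPowerSeries σ K)ˣ) : MvPowerSeries σ K) := by
    rw [mul_right_comm, hJ', one_mul, hU, Finset.prod_inv_distrib]
  have main := subst_diagCoeff_mul (fun i => (oneSubVarProd K G i : MvPowerSeries σ K))
    (goodJacobian K G) (diagCoeff_goodJacobian G) v w hv hw hw0 (fun i => by
      rw [h]
      congr 1
      rw [← substAlgHom_apply hv]
      change _ = ((Units.map (substAlgHom (R := K) hv).toMonoidHom (oneSubVarProd K G i) :
        (MvPowerSeries τ K)ˣ) : MvPowerSeries τ K)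
      rw [oneSubVarProd, map_prod]
      simp only [map_zpow, hmap]) (J' * ((U⁻¹ : (MvPowerSeries σ K)ˣ) : MvPowerSeries σ K))
  rw [hg, diagCoeff_prod_oneSubVar_inv] at main
  -- Multiplying column `j` of the Jacobian by `1 - X_j` clears its denominators.
  have hdet : (Matrix.of fun i j => (if i = j then (o j : MvPowerSeries τ K) else 0) +
      G i j * v j).det = substAlgHom (R := K) hv (goodJacobian K G * U) := by
    have hval : ∀ j, (oneSubVar K j : MvPowerSeries σ K) =
        ofVar K j (PowerSeries.oneSubX K : PowerSeries K) := fun _ => rfl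
    rw [hU, Units.coe_prod]
    simp only [hval]
    rw [goodJacobian_mul, AlgHom.map_det]
    congr 1
    ext i j : 1
    simp only [Matrix.of_apply, AlgHom.mapMatrix_apply, Matrix.map_apply]
    rw [mul_assoc, Units.inv_mul, mul_one, map_add, map_mul, map_intCast, ofVar_X,
      map_add, map_mul, map_intCast, substAlgHom_X, ho]
    congr 1
    split_ifs
    · change _ = substAlgHom hv (oneSubVar K j : MvPowerSeries σ K)
      rw [coe_oneSubVar, map_sub, map_one, substAlgHom_X]
    · rw [map_zero, map_zero]
  rw [main, hdet, ← substAlgHom_apply hv, ← map_mul]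
  rw [show J' * ((U⁻¹ : (MvPowerSeries σ K)ˣ) : MvPowerSeries σ K) * (goodJacobian K G * U) =
    (J' * goodJacobian K G) * (((U⁻¹ : (MvPowerSeries σ K)ˣ) : MvPowerSeries σ K) * U) by ring,
    hJ', Units.inv_mul, one_mul, map_one]

end MvPowerSeries

/-! ### Second differences and the kernel `min(m,k)`. -/

/-- Discrete Green's formula: `min(m,·)` is the Green function of the negative second difference
with value `0` at the origin. The last term is the boundary contribution at the cut-off `n`. -/
lemma sum_min_smul_secondDifference {M : Type*} [AddCommGroup M] (q : ℕ → M) (h0 : q 0 = 0)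
    (m n : ℕ) :
    ∑ k ∈ Finset.range n, ((min m (k + 1) : ℕ) : ℤ) • (q (k + 1) + q (k + 1) - q (k + 2) - q k) =
      q (min m n) + ((min m n : ℕ) : ℤ) • (q n - q (n + 1)) := by
  induction n with
  | zero => simp [h0]
  | succ n ih =>
    rw [Finset.sum_range_succ, ih]
    rcases Nat.lt_or_ge n m with h | h
    · rw [min_eq_right h.le, min_eq_right (Nat.succ_le_of_lt h)]
      push_cast
      module
    · rw [min_eq_left h, min_eq_left (by omega)]
      module

lemma prod_secondDifference_zpow {M : Type*} [CommGroup M] (q : ℕ → M) (h0 : q 0 = 1)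
    (m n : ℕ) :
    ∏ k ∈ Finset.range n, (q (k + 2) * q k * (q (k + 1) ^ 2)⁻¹) ^ (-((min m (k + 1) : ℕ) : ℤ)) =
      q (min m n) * (q n / q (n + 1)) ^ (min m n) := by
  have h := sum_min_smul_secondDifference (fun k => Additive.ofMul (q k)) (by simp [h0]) m n
  apply Additive.ofMul.injective
  rw [ofMul_mul, ofMul_pow, ofMul_div, ← natCast_zsmul, ← h, ofMul_prod]
  refine Finset.sum_congr rfl fun k _ => ?_
  simp only [ofMul_zpow, ofMul_mul, ofMul_inv, ofMul_pow]
  module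

/-- The converse direction: as a function of `m`, `min(m, k+1)` is piecewise linear with its only
kink at `k + 1`, so second differences isolate one factor. -/
lemma secondDifference_prod_zpow {M : Type*} [CommGroup M] (o : ℕ → M) {m n : ℕ} (h : m < n) :
    (∏ k ∈ Finset.range n, o k ^ (-((min (m + 2) (k + 1) : ℕ) : ℤ))) *
      (∏ k ∈ Finset.range n, o k ^ (-((min m (k + 1) : ℕ) : ℤ))) *
      ((∏ k ∈ Finset.range n, o k ^ (-((min (m + 1) (k + 1) : ℕ) : ℤ))) ^ 2)⁻¹ = o m := by
  rw [← Finset.prod_pow, ← Finset.prod_inv_distrib, ← Finset.prod_mul_distrib,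
    ← Finset.prod_mul_distrib, Finset.prod_eq_single m]
  · rw [← zpow_natCast, ← zpow_mul, ← zpow_neg, ← zpow_add, ← zpow_add]
    rw [min_eq_right (by omega : m + 1 ≤ m + 2), min_eq_left (by omega : m ≤ m + 1), min_self]
    push_cast
    ring_nf
    simp
  · intro k _ hk
    rw [← zpow_natCast, ← zpow_mul, ← zpow_neg, ← zpow_add, ← zpow_add]
    convert! zpow_zero _
    push_cast
    omega
  · exact fun hk => absurd (Finset.mem_range.mpr h) hk

/-! ### Units modulo the order filtration. -/

namespace MvPowerSeries

/-- Reduction of units modulo the series of order at least `n`. -/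
def unitsMod {σ R : Type*} [CommRing R] (n : ℕ) :
    (MvPowerSeries σ R)ˣ →* (MvPowerSeries σ R ⧸ orderIdeal σ R n)ˣ :=
  Units.map (Ideal.Quotient.mk (orderIdeal σ R n)).toMonoidHom

lemma unitsMod_eq_iff {σ R : Type*} [CommRing R] {n : ℕ} {x y : (MvPowerSeries σ R)ˣ} :
    unitsMod n x = unitsMod n y ↔ (x - y : MvPowerSeries σ R) ∈ orderIdeal σ R n := by
  rw [Units.ext_iff]
  exact Ideal.Quotient.eq

lemma unitsMod_eq_iff_coeff {σ R : Type*} [CommRing R] {n : ℕ} {x y : (MvPowerSeries σ R)ˣ} :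
    unitsMod n x = unitsMod n y ↔ ∀ d : σ →₀ ℕ, d.degree < n →
      coeff d (x : MvPowerSeries σ R) = coeff d (y : MvPowerSeries σ R) := by
  rw [unitsMod_eq_iff, mem_orderIdeal]
  simp only [map_sub, sub_eq_zero]

lemma unitsMod_eq_of_le {σ R : Type*} [CommRing R] {m n : ℕ} (h : m ≤ n)
    {x y : (MvPowerSeries σ R)ˣ} (hxy : unitsMod n x = unitsMod n y) :
    unitsMod m x = unitsMod m y :=
  unitsMod_eq_iff.mpr (orderIdeal_anti h (unitsMod_eq_iff.mp hxy))

lemma units_ext_of_unitsMod {σ R : Type*} [CommRing R] {x y : (MvPowerSeries σ R)ˣ} (N : ℕ)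
    (h : ∀ n, N ≤ n → unitsMod n x = unitsMod n y) : x = y := by
  ext d
  exact unitsMod_eq_iff_coeff.mp (h (N + d.degree + 1) (by omega)) d (by omega)

lemma unitsMod_zero {σ R : Type*} [CommRing R] (x y : (MvPowerSeries σ R)ˣ) :
    unitsMod 0 x = unitsMod 0 y :=
  unitsMod_eq_iff_coeff.mpr fun _ h => absurd h (Nat.not_lt_zero _)

open Classical in
/-- The unit `1 - f`, for a series `f` without constant term. -/
def oneSub {σ R : Type*} [CommRing R] (f : MvPowerSeries σ R) : (MvPowerSeries σ R)ˣ :=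
  if h : IsUnit (1 - f) then h.unit else 1

lemma coe_oneSub {σ R : Type*} [CommRing R] {f : MvPowerSeries σ R} (h : constantCoeff f = 0) :
    (oneSub f : MvPowerSeries σ R) = 1 - f := by
  have : IsUnit (1 - f) := by
    rw [isUnit_iff_constantCoeff, map_sub, h, map_one, sub_zero]
    exact isUnit_one
  rw [oneSub, dif_pos this, IsUnit.unit_spec]

end MvPowerSeries

open MvPowerSeries

/-! ### The `Q`-system as a product formula; existence and uniqueness. -/

namespace CartanData

variable {I : Type*} [Fintype I] (D : CartanData I)

/-- The product `∏_{(b,k)} (Q_k^{(b)})^{-(α_a|α_b) B_{am,bk}}`. -/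
def qFactor (Q : I → ℕ → (MvPowerSeries I ℂ)ˣ) (a : I) (m : ℕ) : (MvPowerSeries I ℂ)ˣ :=
  ∏ᶠ p : I × ℕ+, Q p.1 p.2 ^ (-D.expo a m p.1 p.2)

lemma qFactor_eq_prod (Q : I → ℕ → (MvPowerSeries I ℂ)ˣ) (a : I) (m K : ℕ)
    (hK : ∀ b, D.t b * m ≤ K) :
    D.qFactor Q a m = ∏ b, ∏ k ∈ Finset.range K, Q b (k + 1) ^ (-D.expo a m b (k + 1)) := by
  classical
  rw [← Finset.prod_product']
  have hinj : Set.InjOn (fun p : I × ℕ => (p.1, Nat.succPNat p.2))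
      ↑((Finset.univ : Finset I) ×ˢ Finset.range K) := by
    rintro ⟨a, k⟩ - ⟨b, j⟩ - h
    simp only [Prod.mk.injEq] at h
    exact Prod.ext h.1 (Nat.succPNat_injective h.2)
  rw [qFactor, finprod_eq_prod_of_mulSupport_subset (s := ((Finset.univ : Finset I) ×ˢ
    Finset.range K).image fun p => (p.1, Nat.succPNat p.2)), Finset.prod_image hinj]
  · rfl
  · rintro ⟨b, k⟩ hp
    simp only [Finset.coe_image, Set.mem_image, Finset.mem_coe, Finset.mem_product,
      Finset.mem_univ, true_and, Finset.mem_range]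
    refine ⟨(b, k.natPred), ?_, by simp⟩
    by_contra hk
    apply hp
    have hlt : D.t b * m < (k : ℕ) := by
      have := PNat.natPred_add_one k
      have := hK b
      simp only at hk
      omega
    simp only [expo, D.B_eq_zero hlt]
    simp

/-- The series `1 - Q_{m+1}^{(a)} Q_{m-1}^{(a)} / (Q_m^{(a)})²` of a `Q`-system. -/
def qV (Q : I → ℕ → (MvPowerSeries I ℂ)ˣ) (a : I) (m : ℕ) : MvPowerSeries I ℂ :=
  (MvPowerSeries.X a : MvPowerSeries I ℂ) ^ m * (D.qFactor Q a m : MvPowerSeries I ℂ)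

lemma constantCoeff_qV (Q : I → ℕ → (MvPowerSeries I ℂ)ˣ) (a : I) (m : ℕ) :
    constantCoeff (D.qV Q a (m + 1)) = 0 := by
  rw [qV, map_mul, map_pow, constantCoeff_X, zero_pow (by omega), zero_mul]

/-- The unit `1 - qV`. -/
def qO (Q : I → ℕ → (MvPowerSeries I ℂ)ˣ) (a : I) (m : ℕ) : (MvPowerSeries I ℂ)ˣ :=
  oneSub (D.qV Q a m)

lemma coe_qO (Q : I → ℕ → (MvPowerSeries I ℂ)ˣ) (a : I) (m : ℕ) :
    (D.qO Q a (m + 1) : MvPowerSeries I ℂ) = 1 - D.qV Q a (m + 1) :=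
  coe_oneSub (D.constantCoeff_qV Q a m)

lemma unitsMod_qO_eq_one (Q : I → ℕ → (MvPowerSeries I ℂ)ˣ) (a : I) {m n : ℕ} (h : n ≤ m + 1) :
    unitsMod n (D.qO Q a (m + 1)) = 1 := by
  rw [← map_one (unitsMod n), unitsMod_eq_iff, coe_qO, Units.val_one, sub_sub_cancel_left]
  exact neg_mem (orderIdeal_anti h (Ideal.mul_mem_right _ _ (X_pow_mem_orderIdeal a (m + 1))))

lemma unitsMod_qFactor_congr {Q Q' : I → ℕ → (MvPowerSeries I ℂ)ˣ} {n : ℕ}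
    (h : ∀ a m, unitsMod n (Q a m) = unitsMod n (Q' a m)) (a : I) (m : ℕ) :
    unitsMod n (D.qFactor Q a m) = unitsMod n (D.qFactor Q' a m) := by
  have hK : ∀ b, D.t b * m ≤ ∑ b, D.t b * m := fun b =>
    Finset.single_le_sum (f := fun b => D.t b * m) (fun _ _ => Nat.zero_le _) (Finset.mem_univ b)
  rw [D.qFactor_eq_prod Q a m _ hK, D.qFactor_eq_prod Q' a m _ hK]
  simp only [map_prod, map_zpow, h]

/-- The prefactor `y_a^{m+1}` improves precision by `m + 1` orders; this is the contraction behind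
both existence and uniqueness. -/
lemma unitsMod_qO_congr {Q Q' : I → ℕ → (MvPowerSeries I ℂ)ˣ} {n : ℕ}
    (h : ∀ a m, unitsMod n (Q a m) = unitsMod n (Q' a m)) (a : I) {m l : ℕ} (hl : l ≤ n + m + 1) :
    unitsMod l (D.qO Q a (m + 1)) = unitsMod l (D.qO Q' a (m + 1)) := by
  rw [unitsMod_eq_iff, coe_qO, coe_qO, sub_sub_sub_cancel_left, qV, qV, ← mul_sub]
  refine orderIdeal_anti (n := m + 1 + n) (by omega)
    (mul_mem_orderIdeal (X_pow_mem_orderIdeal a (m + 1)) ?_)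
  exact unitsMod_eq_iff.mp (D.unitsMod_qFactor_congr h a (m + 1)).symm

/-- The product formula `Q_m^{(a)} = ∏_k (1 - v_k^{(a)})^{-min(m,k)}`, where `v = qV Q`. -/
def IsProductForm (Q : I → ℕ → (MvPowerSeries I ℂ)ˣ) : Prop :=
  ∀ n a m, unitsMod (n + 1) (Q a m) =
    ∏ k ∈ Finset.range n, unitsMod (n + 1) (D.qO Q a (k + 1)) ^ (-((min m (k + 1) : ℕ) : ℤ))

variable {D}

lemma IsQSystem.qO_eq {Q : I → ℕ → (MvPowerSeries I ℂ)ˣ} (h : D.IsQSystem Q) (a : I) (m : ℕ) :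
    D.qO Q a (m + 1) = Q a (m + 2) * Q a m * (Q a (m + 1) ^ 2)⁻¹ := by
  have hrel := h.rel a (m + 1) (by omega)
  rw [eq_mul_inv_iff_mul_eq]
  ext1
  rw [Units.val_mul, Units.val_mul, Units.val_pow_eq_pow_val, coe_qO, qV]
  change _ = _ + _ * ((D.qFactor Q a (m + 1) : (MvPowerSeries I ℂ)ˣ) : MvPowerSeries I ℂ) at hrel
  rw [Nat.add_sub_cancel] at hrel
  linear_combination hrel

/-- Modulo order `n + 1`, the series `v_m` with `m > n` vanish, so the ratios `Q_{m+1}/Q_m` are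
constant from `m = n` on. Convergence forces the constant ratio to be `1`. -/
lemma IsQSystem.unitsMod_eq {Q : I → ℕ → (MvPowerSeries I ℂ)ˣ} (h : D.IsQSystem Q) (a : I)
    {m n : ℕ} (hmn : n ≤ m) : unitsMod (n + 1) (Q a m) = unitsMod (n + 1) (Q a n) := by
  have hrho : ∀ j, unitsMod (n + 1) (Q a (n + j + 1) / Q a (n + j)) =
      unitsMod (n + 1) (Q a (n + 1) / Q a n) := by
    intro j
    induction j with
    | zero => rfl
    | succ j ih =>
      have h1 := D.unitsMod_qO_eq_one Q a (m := n + j) (n := n + 1) (by omega)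
      rw [h.qO_eq] at h1
      rw [← ih, ← div_eq_one, ← map_div, ← h1]
      congr 1
      rw [show n + (j + 1) = n + j + 1 by ring]
      simp only [div_eq_mul_inv, mul_inv, inv_inv, pow_two]
      rw [show n + j + 2 = n + j + 1 + 1 by ring]
      ac_rfl
  obtain ⟨L, hL⟩ := h.conv a
  -- Only finitely many coefficients matter modulo order `n + 1`, so coefficientwise convergence
  -- yields a common bound `M`.
  have hfin : {d : I →₀ ℕ | d.degree < n + 1}.Finite := by
    refine (Finsupp.finite_of_degree_le n).subset fun d hd => ?_
    exact Nat.lt_succ_iff.mp hd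
  have hev : ∀ᶠ m in atTop, ∀ d ∈ {d : I →₀ ℕ | d.degree < n + 1},
      coeff d (Q a m : MvPowerSeries I ℂ) = coeff d L :=
    (eventually_all_finite hfin).mpr fun d _ => hL d
  obtain ⟨M, hM⟩ := eventually_atTop.mp hev
  have hone : unitsMod (n + 1) (Q a (n + 1) / Q a n) = 1 := by
    rw [← hrho M, map_div, div_eq_one, unitsMod_eq_iff_coeff]
    intro d hd
    rw [hM _ (by omega) d hd, hM _ (by omega) d hd]
  obtain ⟨j, rfl⟩ := Nat.exists_eq_add_of_le hmn
  induction j with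
  | zero => rfl
  | succ j ih =>
    rw [← ih (by omega), ← div_eq_one, ← map_div, ← add_assoc, hrho j, hone]

lemma IsQSystem.isProductForm {Q : I → ℕ → (MvPowerSeries I ℂ)ˣ} (h : D.IsQSystem Q) :
    D.IsProductForm Q := by
  intro n a m
  simp only [← map_zpow, ← map_prod, h.qO_eq]
  -- The boundary factor `Q_n / Q_{n+1}` is trivial at this precision by stabilization.
  rw [prod_secondDifference_zpow (Q a) (h.zero a), map_mul, map_pow, map_div,
    h.unitsMod_eq a (Nat.le_succ n), div_self', one_pow, mul_one]
  rcases le_total m n with hmn | hmn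
  · rw [min_eq_left hmn]
  · rw [min_eq_right hmn, h.unitsMod_eq a hmn]

lemma IsProductForm.isQSystem {Q : I → ℕ → (MvPowerSeries I ℂ)ˣ} (h : D.IsProductForm Q) :
    D.IsQSystem Q where
  zero a := by
    refine units_ext_of_unitsMod 1 fun n hn => ?_
    obtain ⟨n, rfl⟩ := Nat.exists_eq_add_of_le' hn
    rw [h, map_one]
    simp
  rel a m hm := by
    obtain ⟨m, rfl⟩ := Nat.exists_eq_add_of_le' hm
    have hO : D.qO Q a (m + 1) = Q a (m + 2) * Q a m * (Q a (m + 1) ^ 2)⁻¹ := by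
      refine units_ext_of_unitsMod (m + 2) fun n hn => ?_
      obtain ⟨n, rfl⟩ := Nat.exists_eq_add_of_le' (show 1 ≤ n by omega)
      simp only [map_mul, map_inv, map_pow, h n a]
      exact (secondDifference_prod_zpow (fun k => unitsMod (n + 1) (D.qO Q a (k + 1)))
        (show m < n by omega)).symm
    rw [eq_mul_inv_iff_mul_eq, Units.ext_iff, Units.val_mul, Units.val_mul,
      Units.val_pow_eq_pow_val, coe_qO, qV] at hO
    change _ = _ + _ * ((D.qFactor Q a (m + 1) : (MvPowerSeries I ℂ)ˣ) : MvPowerSeries I ℂ)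
    rw [Nat.add_sub_cancel]
    linear_combination hO
  conv a := by
    -- A coefficient of total degree `n` only involves `k ≤ n`, where `min(m,k) = k` for every `m ≥
    -- n`; it is thus already final at `m = n`.
    refine ⟨fun d => coeff d (Q a d.degree : MvPowerSeries I ℂ), fun d => ?_⟩
    filter_upwards [eventually_ge_atTop d.degree] with m hm
    have : unitsMod (d.degree + 1) (Q a m) = unitsMod (d.degree + 1) (Q a d.degree) := by
      rw [h, h]
      refine Finset.prod_congr rfl fun k hk => ?_
      have := Finset.mem_range.mp hk
      rw [min_eq_right (by omega : k + 1 ≤ m), min_eq_right (by omega : k + 1 ≤ d.degree)]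
    exact unitsMod_eq_iff_coeff.mp this d (Nat.lt_succ_self _)

lemma IsProductForm.unique {Q Q' : I → ℕ → (MvPowerSeries I ℂ)ˣ} (h : D.IsProductForm Q)
    (h' : D.IsProductForm Q') : Q = Q' := by
  have key : ∀ n a m, unitsMod n (Q a m) = unitsMod n (Q' a m) := by
    intro n
    induction n with
    | zero => exact fun a m => unitsMod_zero _ _
    | succ n ih =>
      intro a m
      rw [h, h']
      exact Finset.prod_congr rfl fun k _ => by rw [D.unitsMod_qO_congr ih a (by omega)]
  funext a m
  exact units_ext_of_unitsMod 0 fun n _ => key n a m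

variable (D)

/-- Successive approximations to the solution of the `Q`-system. -/
def qApprox : ℕ → I → ℕ → (MvPowerSeries I ℂ)ˣ
  | 0 => 1
  | n + 1 => fun a m =>
    ∏ k ∈ Finset.range (n + 1), D.qO (qApprox n) a (k + 1) ^ (-((min m (k + 1) : ℕ) : ℤ))

lemma qApprox_succ (n : ℕ) (a : I) (m : ℕ) : D.qApprox (n + 1) a m =
    ∏ k ∈ Finset.range (n + 1), D.qO (D.qApprox n) a (k + 1) ^ (-((min m (k + 1) : ℕ) : ℤ)) := rfl

/-- The extra factor in the next approximation is trivial at the current precision, and the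
remaining factors agree by contraction. -/
lemma unitsMod_qApprox_succ (n : ℕ) (a : I) (m : ℕ) :
    unitsMod (n + 1) (D.qApprox (n + 1) a m) = unitsMod (n + 1) (D.qApprox n a m) := by
  induction n generalizing a m with
  | zero =>
    rw [qApprox_succ, Finset.prod_range_one, map_zpow, D.unitsMod_qO_eq_one _ a le_rfl,
      one_zpow]
    exact (map_one _).symm
  | succ n ih =>
    conv_lhs => rw [qApprox_succ]
    conv_rhs => rw [qApprox_succ]
    rw [Finset.prod_range_succ, map_mul, map_zpow _ (D.qO _ a (n + 1 + 1)),
      D.unitsMod_qO_eq_one _ a le_rfl, one_zpow, mul_one]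
    simp only [map_prod, map_zpow]
    exact Finset.prod_congr rfl fun k _ => by rw [D.unitsMod_qO_congr ih a (by omega)]

lemma unitsMod_qApprox (n j : ℕ) (a : I) (m : ℕ) :
    unitsMod (n + 1) (D.qApprox (n + j) a m) = unitsMod (n + 1) (D.qApprox n a m) := by
  induction j with
  | zero => rfl
  | succ j ih =>
    rw [← ih]
    exact unitsMod_eq_of_le (by omega) (D.unitsMod_qApprox_succ (n + j) a m)

lemma exists_isProductForm : ∃ Q, D.IsProductForm Q := by
  have hex : ∀ a m, ∃ x : (MvPowerSeries I ℂ)ˣ, ∀ n,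
      unitsMod (n + 1) x = unitsMod (n + 1) (D.qApprox n a m) := by
    intro a m
    -- The limit of the approximations: a coefficient of total degree `n` is stable from the `n`-th
    -- approximation on.
    let f : MvPowerSeries I ℂ := fun d => coeff d (D.qApprox d.degree a m : MvPowerSeries I ℂ)
    have hf : IsUnit f := by
      rw [isUnit_iff_constantCoeff, ← coeff_zero_eq_constantCoeff_apply]
      change IsUnit (coeff 0 (D.qApprox (Finsupp.degree (0 : I →₀ ℕ)) a m : MvPowerSeries I ℂ))
      rw [map_zero, qApprox]
      simp
    refine ⟨hf.unit, fun n => unitsMod_eq_iff_coeff.mpr fun d hd => ?_⟩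
    obtain ⟨j, rfl⟩ := Nat.exists_eq_add_of_le (Nat.lt_succ_iff.mp hd)
    exact (unitsMod_eq_iff_coeff.mp (D.unitsMod_qApprox d.degree j a m) d
      (Nat.lt_succ_self _)).symm
  choose Q hQ using hex
  refine ⟨Q, fun n a m => ?_⟩
  rw [hQ, ← D.unitsMod_qApprox_succ, qApprox_succ, Finset.prod_range_succ, map_mul,
    map_zpow _ (D.qO _ a (n + 1)), D.unitsMod_qO_eq_one _ a le_rfl, one_zpow, mul_one]
  simp only [map_prod, map_zpow]
  exact Finset.prod_congr rfl fun k _ => by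
    rw [D.unitsMod_qO_congr (fun a m => hQ a m n) a (by omega)]

theorem existsUnique_isQSystem : ∃! Q, D.IsQSystem Q := by
  obtain ⟨Q, hQ⟩ := D.exists_isProductForm
  exact ⟨Q, hQ.isQSystem, fun Q' hQ' => hQ'.isProductForm.unique hQ⟩

end CartanData

/-- Since `f` may take equal values, the matrix is only block triangular; the off-diagonal entries
inside a block vanish by strictness, so each diagonal block is the identity. -/
lemma Matrix.det_eq_one_of_lt {σ S α : Type*} [CommRing S] [Fintype σ] [DecidableEq σ]
    [LinearOrder α] (f : σ → α) (M : Matrix σ σ S) (h1 : ∀ i, M i i = 1)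
    (h : ∀ i j, i ≠ j → M i j ≠ 0 → f j < f i) : M.det = 1 := by
  have hM : M.BlockTriangular (fun i => OrderDual.toDual (f i)) := by
    intro i j hij
    by_contra hne
    have hlt : f i < f j := hij
    exact lt_asymm hlt (h i j (by rintro rfl; exact lt_irrefl _ hlt) hne)
  rw [hM.det]
  refine Finset.prod_eq_one fun k _ => ?_
  have : M.toSquareBlock (fun i => OrderDual.toDual (f i)) k = 1 := by
    ext ⟨i, hi⟩ ⟨j, hj⟩
    rw [Matrix.toSquareBlock_def, Matrix.of_apply, Matrix.one_apply]
    split_ifs with hij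
    · obtain rfl : i = j := congrArg Subtype.val hij
      exact h1 i
    · by_contra hne
      have hlt := h i j (fun e => hij (Subtype.ext e)) hne
      rw [OrderDual.toDual.injective (hj.trans hi.symm)] at hlt
      exact lt_irrefl _ hlt
  rw [this, Matrix.det_one]

lemma Finset.prod_zpow_prod_zpow {ι κ M : Type*} [CommGroup M] (s : Finset κ) (t : Finset ι)
    (o : ι → M) (g : κ → ι → ℤ) (e : κ → ℤ) :
    ∏ x ∈ s, (∏ k ∈ t, o k ^ g x k) ^ e x = ∏ k ∈ t, o k ^ ∑ x ∈ s, g x k * e x := by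
  simp only [← Finset.prod_zpow]
  rw [Finset.prod_comm]
  refine Finset.prod_congr rfl fun k _ => ?_
  rw [← Finset.prod_zpow_eq_zpow_sum]
  exact Finset.prod_congr rfl fun x _ => (zpow_mul _ _ _).symm

/-! ### Euler derivations. -/

namespace MvPowerSeries

/-- The Euler derivation `X_c ∂/∂X_c`. -/
def euler {σ : Type*} (R : Type*) [CommRing R] (c : σ) :
    Derivation R (MvPowerSeries σ R) (MvPowerSeries σ R) :=
  (X c : MvPowerSeries σ R) • pderiv R c

lemma euler_apply {σ R : Type*} [CommRing R] (c : σ) (f : MvPowerSeries σ R) :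
    euler R c f = X c * pderiv R c f := rfl

lemma coeff_euler {σ R : Type*} [CommRing R] (c : σ) (f : MvPowerSeries σ R) (d : σ →₀ ℕ) :
    coeff d (euler R c f) = d c * coeff d f := by
  classical
  rw [euler_apply]
  by_cases hi : d c = 0
  · rw [X_def, coeff_monomial_mul, if_neg, hi, Nat.cast_zero, zero_mul]
    rw [Finsupp.single_le_iff]; omega
  · obtain ⟨e, rfl⟩ : ∃ e, d = e + Finsupp.single c 1 := by
      refine ⟨d - Finsupp.single c 1, ?_⟩
      rw [tsub_add_cancel_of_le]
      rw [Finsupp.single_le_iff]; omega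
    rw [add_comm e, X_def, coeff_add_monomial_mul, one_mul, coeff_pderiv, add_comm e]
    simp [mul_comm, add_comm]

lemma euler_mem_orderIdeal {σ R : Type*} [CommRing R] {n : ℕ} (c : σ) {f : MvPowerSeries σ R}
    (hf : f ∈ orderIdeal σ R n) : euler R c f ∈ orderIdeal σ R n := by
  intro d hd
  rw [coeff_euler, hf d hd, mul_zero]

lemma euler_X_pow {σ R : Type*} [CommRing R] [DecidableEq σ] (a c : σ) (m : ℕ) :
    euler R c (X a ^ m) = X a ^ m * (if a = c then (m : MvPowerSeries σ R) else 0) := by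
  ext d
  rw [coeff_euler]
  split_ifs with h
  · subst h
    rw [mul_comm (X a ^ m), ← map_natCast (C (σ := σ) (R := R)), coeff_C_mul, coeff_X_pow]
    split_ifs with hd
    · rw [hd, Finsupp.single_eq_same]
    · simp
  · rw [mul_zero, map_zero, coeff_X_pow]
    split_ifs with hd
    · rw [hd, Finsupp.single_eq_of_ne (Ne.symm h)]; simp
    · simp

lemma unitsLog_euler_mem_orderIdeal {σ R : Type*} [CommRing R] {n : ℕ} (c : σ)
    {u : (MvPowerSeries σ R)ˣ} (hu : unitsMod n u = 1) :
    (euler R c).unitsLog (Additive.ofMul u) ∈ orderIdeal σ R n := by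
  rw [← map_one (unitsMod n), unitsMod_eq_iff] at hu
  have := euler_mem_orderIdeal c hu
  rw [map_sub, Units.val_one, Derivation.map_one_eq_zero, sub_zero] at this
  exact Ideal.mul_mem_left _ _ this

end MvPowerSeries

/-! ### Truncation to `m ≤ l` and the Jacobian determinant. -/

namespace CartanData

variable {I : Type*} [Fintype I] (D : CartanData I)

/-- The integer `(α_a|α_b) min(t_b m, t_a k)`. -/
def gramMin (a : I) (m : ℕ) (b : I) (k : ℕ) : ℤ :=
  if D.t b * m ≤ D.t a * k then D.cartan b a * m else D.cartan a b * k

lemma cast_gramMin (a : I) (m : ℕ) (b : I) (k : ℕ) :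
    (D.gramMin a m b k : ℚ) = D.gram a b * (min (D.t b * m) (D.t a * k) : ℕ) := by
  unfold gramMin
  split_ifs with h
  · rw [min_eq_left h]
    push_cast
    rw [D.cartan_eq, D.gram_symm b a]; ring
  · rw [min_eq_right (by omega)]
    push_cast
    rw [D.cartan_eq]; ring

lemma gramMin_symm (a : I) (m : ℕ) (b : I) (k : ℕ) : D.gramMin a m b k = D.gramMin b k a m := by
  have h1 := D.cast_gramMin a m b k
  rw [D.gram_symm, min_comm, ← D.cast_gramMin b k a m] at h1
  exact_mod_cast h1

/-- `B_{am,bk}` is the negative second difference in `k` of `min(t_b m, t_a k)`, so summation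
against `min(j,k)` recovers that function. Beyond `K` it is constant, which kills the boundary term.
-/
lemma sum_min_mul_expo (a : I) (m : ℕ) (b : I) (j K : ℕ) (hj : j ≤ K) (hK : D.t b * m ≤ K) :
    ∑ k ∈ Finset.range K, ((min j (k + 1) : ℕ) : ℤ) * D.expo a m b (k + 1) =
      D.gramMin a m b j := by
  have h := sum_min_smul_secondDifference
    (fun k => ((min (D.t b * m) (D.t a * k) : ℕ) : ℤ)) (by simp) j K
  have hK1 : D.t b * m ≤ D.t a * K := hK.trans (Nat.le_mul_of_pos_left K (D.t_pos a))
  have hK2 : D.t b * m ≤ D.t a * (K + 1) := hK1.trans (Nat.mul_le_mul_left _ (by omega))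
  simp only [min_eq_left hj, min_eq_left hK1, min_eq_left hK2, sub_self, mul_zero,
    add_zero, smul_eq_mul] at h
  have h2 := congrArg (fun z : ℤ => D.gram a b * (z : ℚ)) h
  simp only [Int.cast_natCast, ← D.cast_gramMin] at h2
  have h3 : ((∑ k ∈ Finset.range K, ((min j (k + 1) : ℕ) : ℤ) * D.expo a m b (k + 1) : ℤ) : ℚ) =
      D.gramMin a m b j := by
    rw [← h2]
    push_cast
    rw [Finset.mul_sum]
    refine Finset.sum_congr rfl fun k _ => ?_
    rw [D.cast_expo, B, Nat.add_sub_cancel, add_assoc k 1 1, one_add_one_eq_two]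
    push_cast
    ring
  exact_mod_cast h3

lemma IsProductForm.unitsMod_qFactor {D : CartanData I} {Q : I → ℕ → (MvPowerSeries I ℂ)ˣ}
    (h : D.IsProductForm Q) (l : ℕ) (a : I) (m : ℕ) :
    unitsMod (l + 1) (D.qFactor Q a m) = ∏ b, ∏ j ∈ Finset.range l,
      unitsMod (l + 1) (D.qO Q b (j + 1)) ^ D.gramMin a m b (j + 1) := by
  have hK : ∀ b, D.t b * m ≤ l + ∑ b, D.t b * m := fun b =>
    (Finset.single_le_sum (f := fun b => D.t b * m) (fun _ _ => Nat.zero_le _)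
      (Finset.mem_univ b)).trans (Nat.le_add_left _ _)
  rw [D.qFactor_eq_prod Q a m _ hK, map_prod]
  refine Finset.prod_congr rfl fun b _ => ?_
  simp only [map_prod, map_zpow, h l b]
  refine (Finset.prod_zpow_prod_zpow _ _ _ _ _).trans ?_
  refine Finset.prod_congr rfl fun j hj => ?_
  rw [← D.sum_min_mul_expo a m b (j + 1) _ (by have := Finset.mem_range.mp hj; omega) (hK b)]
  simp only [neg_mul_neg, min_comm]

section Level

variable (Q : I → ℕ → (MvPowerSeries I ℂ)ˣ) (l : ℕ)

/-- The units `1 - v_j`, `j = (b, k)` with `k ≤ l`. -/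
def levelO (j : I × Fin l) : (MvPowerSeries I ℂ)ˣ := D.qO Q j.1 (j.2 + 1)

/-- The series `v_j`, `j = (b, k)` with `k ≤ l`. -/
def levelV (j : I × Fin l) : MvPowerSeries I ℂ := D.qV Q j.1 (j.2 + 1)

/-- The matrix `(α_a|α_b) min(t_b m, t_a k)` for `m, k ≤ l`. -/
def levelG (i j : I × Fin l) : ℤ := D.gramMin i.1 (i.2 + 1) j.1 (j.2 + 1)

/-- The quotient of `v_i / y_a^m` by `∏_j (1 - v_j)^{G_ij}`. -/
def levelS (i : I × Fin l) : (MvPowerSeries I ℂ)ˣ :=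
  D.qFactor Q i.1 (i.2 + 1) * (∏ j, D.levelO Q l j ^ D.levelG l i j)⁻¹

/-- The quotient of `v_i` by `∏_j (1 - v_j)^{G_ij}`. -/
def levelW (i : I × Fin l) : MvPowerSeries I ℂ :=
  X i.1 ^ ((i.2 : ℕ) + 1) * (D.levelS Q l i : MvPowerSeries I ℂ)

lemma coe_levelO (j : I × Fin l) :
    (D.levelO Q l j : MvPowerSeries I ℂ) = 1 - D.levelV Q l j := D.coe_qO Q _ _

lemma constantCoeff_levelW (i : I × Fin l) : constantCoeff (D.levelW Q l i) = 0 := by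
  rw [levelW, map_mul, map_pow, constantCoeff_X, zero_pow (by omega), zero_mul]

lemma levelS_mul (i : I × Fin l) : D.levelS Q l i * ∏ j, D.levelO Q l j ^ D.levelG l i j =
    D.qFactor Q i.1 (i.2 + 1) := by
  rw [levelS, inv_mul_cancel_right]

lemma levelV_eq (i : I × Fin l) : D.levelV Q l i = D.levelW Q l i *
    ((∏ j, D.levelO Q l j ^ D.levelG l i j : (MvPowerSeries I ℂ)ˣ) : MvPowerSeries I ℂ) := by
  rw [levelV, qV, ← D.levelS_mul, levelW, Units.val_mul, mul_assoc]

variable {D Q}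

/-- The truncation error is invisible modulo order `l + 1`, so `levelW` agrees there with the
monomial `y_a^m`, although the equation for `v` in terms of `levelW` is exact. -/
lemma IsProductForm.unitsMod_levelS (h : D.IsProductForm Q) (i : I × Fin l) :
    unitsMod (l + 1) (D.levelS Q l i) = 1 := by
  rw [levelS, map_mul, map_inv, mul_inv_eq_one, h.unitsMod_qFactor, map_prod,
    Fintype.prod_prod_type]
  refine Finset.prod_congr rfl fun b _ => ?_
  rw [Finset.prod_range]
  refine Finset.prod_congr rfl fun j _ => ?_
  rw [map_zpow]
  rfl

variable (D Q)

/-- The truncated product formula for `Q_1^{(a)}`. -/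
def levelQ (a : I) : (MvPowerSeries I ℂ)ˣ := ∏ k : Fin l, (D.levelO Q l (a, k))⁻¹

variable {D Q}

lemma IsProductForm.unitsMod_levelQ (h : D.IsProductForm Q) (a : I) :
    unitsMod (l + 1) (Q a 1) = unitsMod (l + 1) (D.levelQ Q l a) := by
  rw [h, Finset.prod_range, levelQ, map_prod]
  refine Finset.prod_congr rfl fun k _ => ?_
  rw [min_eq_left (by omega), Nat.cast_one, zpow_neg_one, map_inv]
  rfl

variable (D Q)

lemma prod_levelQ : ∏ a, D.levelQ Q l a = ∏ j, (D.levelO Q l j)⁻¹ := by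
  rw [Fintype.prod_prod_type]; rfl

/-- The series `v_j / (1 - v_j)`. -/
def levelZ (j : I × Fin l) : MvPowerSeries I ℂ :=
  D.levelV Q l j * ((D.levelO Q l j)⁻¹ : (MvPowerSeries I ℂ)ˣ)

variable [DecidableEq I]

/-- The logarithmic derivative of `v_i` with respect to `log y_c`. -/
def levelL (i : I × Fin l) (c : I) : MvPowerSeries I ℂ :=
  (if i.1 = c then (((i.2 : ℕ) + 1 : ℕ) : MvPowerSeries I ℂ) else 0) +
    (euler ℂ c).unitsLog (Additive.ofMul (D.qFactor Q i.1 (i.2 + 1)))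

lemma euler_levelV (i : I × Fin l) (c : I) :
    euler ℂ c (D.levelV Q l i) = D.levelV Q l i * D.levelL Q l i c := by
  rw [levelV, qV, Derivation.leibniz, euler_X_pow, Derivation.apply_unit, levelL]
  simp only [smul_eq_mul]
  ring

lemma unitsLog_levelO (i : I × Fin l) (c : I) :
    (euler ℂ c).unitsLog (Additive.ofMul (D.levelO Q l i)) =
      -(D.levelZ Q l i * D.levelL Q l i c) := by
  change (((D.levelO Q l i)⁻¹ : (MvPowerSeries I ℂ)ˣ) : MvPowerSeries I ℂ) *
    euler ℂ c (D.levelO Q l i : MvPowerSeries I ℂ) = _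
  rw [coe_levelO, map_sub, Derivation.map_one_eq_zero, euler_levelV, levelZ]
  ring

/-- Logarithmic derivative of `v_i = w_i ∏_j (1 - v_j)^{G_ij}`: in matrix form, `(1 + GZ)L` is
explicit up to the contribution of `levelS`. -/
lemma levelL_add_sum (i : I × Fin l) (c : I) :
    D.levelL Q l i c + ∑ j, (D.levelG l i j : MvPowerSeries I ℂ) *
      (D.levelZ Q l j * D.levelL Q l j c) =
    (if i.1 = c then (((i.2 : ℕ) + 1 : ℕ) : MvPowerSeries I ℂ) else 0) +
      (euler ℂ c).unitsLog (Additive.ofMul (D.levelS Q l i)) := by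
  rw [levelL, ← D.levelS_mul, ofMul_mul, map_add, ofMul_prod, map_sum]
  simp only [ofMul_zpow, map_zsmul, unitsLog_levelO, zsmul_eq_mul, mul_neg,
    Finset.sum_neg_distrib]
  ring

lemma unitsLog_levelQ (a c : I) :
    (euler ℂ c).unitsLog (Additive.ofMul (D.levelQ Q l a)) =
      ∑ k : Fin l, D.levelZ Q l (a, k) * D.levelL Q l (a, k) c := by
  rw [levelQ, ofMul_prod, map_sum]
  refine Finset.sum_congr rfl fun k _ => ?_
  rw [ofMul_inv, map_neg, unitsLog_levelO, neg_neg]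

/-- The matrix `δ_ab f_a - ∑_c C_bc y_c ∂f_a/∂y_c`, i.e. `x_b / x_a` times the matrix of partial
derivatives of `x_a f_a(y(x))`. -/
def jacobianMatrix (f : I → MvPowerSeries I ℂ) : Matrix I I (MvPowerSeries I ℂ) :=
  Matrix.of fun a b => (if a = b then f a else 0) -
    ∑ c, (D.cartan b c : MvPowerSeries I ℂ) * euler ℂ c (f a)

/-- The matrix `δ_ij + G_ij v_j / (1 - v_j)`. -/
def levelMatrix : Matrix (I × Fin l) (I × Fin l) (MvPowerSeries I ℂ) :=
  Matrix.of fun i j => (if i = j then 1 else 0) +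
    (D.levelG l i j : MvPowerSeries I ℂ) * D.levelZ Q l j

/-- The matrix `-∂ log v_i / ∂ log x_b`. -/
def levelLC : Matrix (I × Fin l) I (MvPowerSeries I ℂ) :=
  Matrix.of fun i b => ∑ c, (D.cartan b c : MvPowerSeries I ℂ) * D.levelL Q l i c

/-- The matrix whose `a`-th row has entries `v_j / (1 - v_j)` at the indices `j = (a, k)`. -/
def levelEZ : Matrix I (I × Fin l) (MvPowerSeries I ℂ) :=
  Matrix.of fun a j => if a = j.1 then D.levelZ Q l j else 0

lemma jacobianMatrix_levelQ :
    D.jacobianMatrix (fun a => (D.levelQ Q l a : MvPowerSeries I ℂ)) =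
      Matrix.of fun a b => (D.levelQ Q l a : MvPowerSeries I ℂ) *
        (1 - D.levelEZ Q l * D.levelLC Q l : Matrix I I (MvPowerSeries I ℂ)) a b := by
  ext a b : 1
  simp only [jacobianMatrix, Matrix.of_apply, Matrix.sub_apply, Matrix.one_apply, Matrix.mul_apply,
    levelEZ, levelLC, Fintype.sum_prod_type, ite_mul, zero_mul]
  rw [mul_sub]
  congr 1
  · split_ifs <;> simp
  · rw [Finset.sum_comm]
    simp only [Finset.sum_ite_eq, Finset.mem_univ, if_true]
    simp only [Derivation.apply_unit, unitsLog_levelQ, Finset.mul_sum]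
    rw [Finset.sum_comm]
    refine Finset.sum_congr rfl fun k _ => Finset.sum_congr rfl fun c _ => ?_
    ring

/-- The row factors `Q_1^{(a)}` of the Jacobian cancel the column factors `1 - v_j` of the other
determinant, and `det(1 - AB) = det(1 - BA)` brings both to size `I × Fin l`. The product then
contains `levelMatrix * levelLC`, which no longer involves the unknown derivatives of `v`. -/
lemma det_jacobianMatrix_levelQ_mul :
    (D.jacobianMatrix (fun a => (D.levelQ Q l a : MvPowerSeries I ℂ))).det *
      (Matrix.of fun i j => (if i = j then (D.levelO Q l j : MvPowerSeries I ℂ) else 0) +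
        D.levelG l i j * D.levelV Q l j).det =
      (D.levelMatrix Q l - D.levelMatrix Q l * D.levelLC Q l * D.levelEZ Q l).det := by
  have h1 : (Matrix.of fun i j => (if i = j then (D.levelO Q l j : MvPowerSeries I ℂ) else 0) +
      D.levelG l i j * D.levelV Q l j) =
      Matrix.of fun i j => (D.levelO Q l j : MvPowerSeries I ℂ) * D.levelMatrix Q l i j := by
    ext i j : 1
    simp only [Matrix.of_apply, levelMatrix, levelZ]
    rw [mul_add]
    congr 1
    · split_ifs <;> simp
    · have := (D.levelO Q l j).mul_inv
      linear_combination (-(D.levelG l i j : MvPowerSeries I ℂ) * D.levelV Q l j) * this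
  have h2 : (∏ a, (D.levelQ Q l a : MvPowerSeries I ℂ)) *
      ∏ j, (D.levelO Q l j : MvPowerSeries I ℂ) = 1 := by
    rw [← Units.coe_prod, ← Units.coe_prod, ← Units.val_mul, prod_levelQ,
      ← Finset.prod_mul_distrib]
    simp
  rw [jacobianMatrix_levelQ, Matrix.det_mul_column, h1, Matrix.det_mul_row,
    Matrix.det_one_sub_mul_comm, Matrix.mul_assoc, ← mul_one_sub, Matrix.det_mul]
  linear_combination (((1 : Matrix (I × Fin l) (I × Fin l) (MvPowerSeries I ℂ)) -
    D.levelLC Q l * D.levelEZ Q l).det * (D.levelMatrix Q l).det) * h2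

lemma levelMatrix_mul_levelLC (i : I × Fin l) (b : I) : (D.levelMatrix Q l * D.levelLC Q l) i b =
    D.cartan b i.1 * (((i.2 : ℕ) + 1 : ℕ) : MvPowerSeries I ℂ) +
      ∑ c, (D.cartan b c : MvPowerSeries I ℂ) *
        (euler ℂ c).unitsLog (Additive.ofMul (D.levelS Q l i)) := by
  have h : (D.levelMatrix Q l * D.levelLC Q l) i b = ∑ c, (D.cartan b c : MvPowerSeries I ℂ) *
      (D.levelL Q l i c + ∑ j, (D.levelG l i j : MvPowerSeries I ℂ) *
      (D.levelZ Q l j * D.levelL Q l j c)) := by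
    simp only [Matrix.mul_apply, levelMatrix, levelLC, Matrix.of_apply, add_mul, ite_mul, one_mul,
      zero_mul, Finset.sum_add_distrib, Finset.sum_ite_eq, Finset.mem_univ, if_true, mul_add]
    congr 1
    simp only [Finset.mul_sum]
    rw [Finset.sum_comm]
    refine Finset.sum_congr rfl fun c _ => Finset.sum_congr rfl fun j _ => ?_
    ring
  rw [h]
  simp only [levelL_add_sum, mul_add, mul_ite, mul_zero, Finset.sum_add_distrib,
    Finset.sum_ite_eq, Finset.mem_univ, if_true]

variable {D Q}

lemma IsProductForm.mk_det_jacobianMatrix_levelQ_mul (h : D.IsProductForm Q) :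
    Ideal.Quotient.mk (orderIdeal I ℂ (l + 1))
      ((D.jacobianMatrix (fun a => (D.levelQ Q l a : MvPowerSeries I ℂ))).det *
      (Matrix.of fun i j => (if i = j then (D.levelO Q l j : MvPowerSeries I ℂ) else 0) +
        D.levelG l i j * D.levelV Q l j).det) = 1 := by
  rw [det_jacobianMatrix_levelQ_mul, RingHom.map_det]
  -- At this precision the `levelS` term drops out, leaving `1 + (G - H)Z` with `H_ij = C_ba m`; the
  -- index `i.2` stands for `m - 1`.
  have hent : ∀ i j, (Ideal.Quotient.mk (orderIdeal I ℂ (l + 1)))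
      ((D.levelMatrix Q l - D.levelMatrix Q l * D.levelLC Q l * D.levelEZ Q l) i j) =
      (if i = j then 1 else 0) + ((D.levelG l i j - D.cartan j.1 i.1 * ((i.2 : ℕ) + 1) : ℤ) :
        MvPowerSeries I ℂ ⧸ orderIdeal I ℂ (l + 1)) *
        Ideal.Quotient.mk (orderIdeal I ℂ (l + 1)) (D.levelZ Q l j) := by
    intro i j
    have hS : Ideal.Quotient.mk (orderIdeal I ℂ (l + 1))
        (∑ c, (D.cartan j.1 c : MvPowerSeries I ℂ) *
        (euler ℂ c).unitsLog (Additive.ofMul (D.levelS Q l i))) = 0 := by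
      rw [Ideal.Quotient.eq_zero_iff_mem]
      exact Ideal.sum_mem _ fun c _ => Ideal.mul_mem_left _ _
        (unitsLog_euler_mem_orderIdeal c (h.unitsMod_levelS l i))
    rw [Matrix.sub_apply, Matrix.mul_apply]
    simp only [levelMatrix_mul_levelLC]
    simp only [levelEZ, Matrix.of_apply, mul_ite, mul_zero, Finset.sum_ite_eq', Finset.mem_univ,
      if_true]
    rw [map_sub, map_mul, map_add, hS, levelMatrix, Matrix.of_apply, map_add, map_mul, map_mul,
      map_intCast, map_intCast, map_natCast]
    have hite : Ideal.Quotient.mk (orderIdeal I ℂ (l + 1)) (if i = j then 1 else 0) =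
        if i = j then 1 else 0 := by split_ifs <;> simp
    rw [hite]
    push_cast
    ring
  -- `G_ij` differs from `C_ba m` only when the minimum of `t_b m` and `t_a k` is `t_a k < t_b m`,
  -- that is, when `k / t_b < m / t_a`.
  refine Matrix.det_eq_one_of_lt (fun i : I × Fin l => ((i.2 : ℕ) + 1 : ℚ) / D.t i.1) _ ?_ ?_
  · intro i
    rw [RingHom.mapMatrix_apply, Matrix.map_apply, hent, if_pos rfl, levelG, gramMin,
      if_pos le_rfl]
    push_cast
    simp
  · intro i j hij hne
    rw [RingHom.mapMatrix_apply, Matrix.map_apply, hent, if_neg hij, zero_add] at hne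
    have hlt : D.t i.1 * ((j.2 : ℕ) + 1) < D.t j.1 * ((i.2 : ℕ) + 1) := by
      by_contra hle
      refine hne ?_
      rw [levelG, gramMin, if_pos (not_lt.mp hle)]
      push_cast
      simp
    have hi : (0 : ℚ) < D.t i.1 := by exact_mod_cast D.t_pos i.1
    have hj : (0 : ℚ) < D.t j.1 := by exact_mod_cast D.t_pos j.1
    rw [div_lt_div_iff₀ hj hi]
    have : (D.t i.1 : ℚ) * ((j.2 : ℕ) + 1) < D.t j.1 * ((i.2 : ℕ) + 1) := by exact_mod_cast hlt
    linarith

lemma IsProductForm.subst_levelW_sub_mem (h : D.IsProductForm Q) :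
    subst (D.levelW Q l) (binomialProdSeries ℂ (D.levelG l)) -
      (D.jacobianMatrix (fun a => (Q a 1 : MvPowerSeries I ℂ))).det ∈ orderIdeal I ℂ (l + 1) := by
  rw [← Ideal.Quotient.eq]
  have h1 := subst_binomialProdSeries_mul_det (D.levelG l) (D.levelV Q l) (D.levelW Q l)
    (D.levelO Q l) (D.coe_levelO Q l) (D.constantCoeff_levelW Q l) (D.levelV_eq Q l)
  have h2 := h.mk_det_jacobianMatrix_levelQ_mul l
  have h3 : Ideal.Quotient.mk (orderIdeal I ℂ (l + 1))
      (D.jacobianMatrix (fun a => (Q a 1 : MvPowerSeries I ℂ))).det =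
      Ideal.Quotient.mk (orderIdeal I ℂ (l + 1))
        (D.jacobianMatrix (fun a => (D.levelQ Q l a : MvPowerSeries I ℂ))).det := by
    rw [RingHom.map_det, RingHom.map_det]
    congr 1
    ext a b : 1
    simp only [RingHom.mapMatrix_apply, Matrix.map_apply, jacobianMatrix, Matrix.of_apply]
    have hQ := unitsMod_eq_iff.mp (h.unitsMod_levelQ l a)
    have he : ∀ c, Ideal.Quotient.mk (orderIdeal I ℂ (l + 1))
        (euler ℂ c (Q a 1 : MvPowerSeries I ℂ)) = Ideal.Quotient.mk (orderIdeal I ℂ (l + 1))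
        (euler ℂ c (D.levelQ Q l a : MvPowerSeries I ℂ)) := by
      intro c
      rw [Ideal.Quotient.eq, ← map_sub]
      exact euler_mem_orderIdeal c hQ
    simp only [map_sub, map_sum, map_mul, he]
    congr 1
    split_ifs
    · exact Ideal.Quotient.eq.mpr hQ
    · rfl
  rw [h3]
  have h4 := congrArg (Ideal.Quotient.mk (orderIdeal I ℂ (l + 1))) h1
  rw [map_mul, map_one] at h4
  rw [map_mul] at h2
  -- The substituted series and the Jacobian are both inverse to the same determinant modulo order
  -- `l + 1`.
  exact (left_inv_eq_right_inv h4 ((mul_comm _ _).trans h2))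

end Level

end CartanData

/-! ### Comparison with the coefficients of `KTilde`. -/

namespace MvPowerSeries

lemma prod_X_pow_eq_monomial {ι σ R : Type*} [CommRing R] (s : Finset ι) (g : ι → σ) (n : ι → ℕ) :
    ∏ i ∈ s, (X (g i) : MvPowerSeries σ R) ^ n i =
      monomial (∑ i ∈ s, Finsupp.single (g i) (n i)) 1 := by
  classical
  induction s using Finset.induction_on with
  | empty => simp
  | insert a s ha ih =>
    rw [Finset.prod_insert ha, Finset.sum_insert ha, ih, X_pow_eq, monomial_mul_monomial, one_mul]

end MvPowerSeries

namespace CartanData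

variable {I : Type*} [Fintype I] (D : CartanData I)

/-- The inclusion of the index set `{(a, m) : 1 ≤ m ≤ l}`. -/
def levelEmb (I : Type*) (l : ℕ) : I × Fin l ↪ I × ℕ+ where
  toFun j := (j.1, Nat.succPNat j.2)
  inj' := by
    rintro ⟨a, k⟩ ⟨b, j⟩ h
    simp only [Prod.mk.injEq] at h
    exact Prod.ext h.1 (Fin.ext (Nat.succPNat_injective h.2))

lemma yDegree_embDomain (l : ℕ) (N : I × Fin l →₀ ℕ) :
    D.yDegree (N.embDomain (levelEmb I l)) =
      ⇑(∑ j ∈ N.support, Finsupp.single j.1 (((j.2 : ℕ) + 1) * N j)) := by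
  classical
  funext a
  rw [yDegree, Finsupp.sum_embDomain, Finsupp.sum, Finsupp.finsetSum_apply]
  refine Finset.sum_congr rfl fun j _ => ?_
  rw [Finsupp.single_apply]
  exact if_congr Iff.rfl rfl rfl

/-- A nonzero `N_k^{(b)}` contributes at least `k` to the exponent of `y_b`, so low-degree monomials
see only `k ≤ l`. -/
lemma exists_embDomain_eq (l : ℕ) (N : I × ℕ+ →₀ ℕ) (d : I →₀ ℕ) (hd : d.degree ≤ l)
    (hN : D.yDegree N = ⇑d) : ∃ N' : I × Fin l →₀ ℕ, N'.embDomain (levelEmb I l) = N := by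
  classical
  rw [← Set.mem_range, Finsupp.mem_range_embDomain_iff]
  rintro ⟨b, k⟩ hp
  have hk : (k : ℕ) ≤ l := by
    refine le_trans ?_ ((Finsupp.le_degree b d).trans hd)
    rw [← hN, yDegree]
    have h1 := Finset.single_le_sum
      (f := fun p : I × ℕ+ => if p.1 = b then (p.2 : ℕ) * N p else 0)
      (fun _ _ => Nat.zero_le _) hp
    have h2 : (k : ℕ) ≤ k * N (b, k) :=
      Nat.le_mul_of_pos_right _ (Nat.pos_of_ne_zero (Finsupp.mem_support_iff.mp hp))
    simp only [if_true] at h1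
    exact h2.trans (h1.trans (Finset.sum_le_sum fun p _ => le_of_eq (if_congr Iff.rfl rfl rfl)))
  have hk1 := PNat.natPred_add_one k
  exact ⟨(b, ⟨k.natPred, by omega⟩), Prod.ext rfl (PNat.succPNat_natPred k)⟩

lemma KNum_zero_embDomain (l : ℕ) (N : I × Fin l →₀ ℕ) :
    (D.KNum 0 (N.embDomain (levelEmb I l)) : ℂ) =
      coeff N (binomialProdSeries ℂ (D.levelG l)) := by
  have hv : ∀ j : I × Fin l, D.vacancy 0 (N.embDomain (levelEmb I l)) j.1 (j.2 + 1) =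
      ((-(∑ i, N i * D.levelG l i j) : ℤ) : ℚ) := by
    intro j
    rw [vacancy, gamma, Finsupp.sum_zero_index, Finsupp.sum_embDomain,
      Finsupp.sum_fintype _ _ (fun _ => by simp), Nat.cast_zero, zero_sub]
    rw [Int.cast_neg, Int.cast_sum, neg_inj]
    refine Finset.sum_congr rfl fun i _ => ?_
    -- The vacancy number sums over the second index of the form, Good's formula over the first;
    -- symmetry reconciles them.
    rw [Int.cast_mul, Int.cast_natCast, levelG, D.gramMin_symm, D.cast_gramMin]
    exact mul_comm _ _
  have h1 : D.KNum 0 (N.embDomain (levelEmb I l)) =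
      ((∏ j, Ring.choose (-(∑ i, N i * D.levelG l i j) + N j : ℤ) (N j) : ℤ) : ℚ) := by
    rw [KNum, Finsupp.prod_embDomain, Finsupp.prod_fintype _ _ (fun _ => by
      rw [Ring.choose_zero_right])]
    rw [Int.cast_prod]
    refine Finset.prod_congr rfl fun j _ => ?_
    change Ring.choose (D.vacancy 0 (N.embDomain (levelEmb I l)) j.1 (j.2 + 1) + _) _ = _
    rw [hv, ← Int.cast_natCast (N j), ← Int.cast_add]
    exact (Ring.map_choose (Int.castRingHom ℚ) _ _).symm
  rw [h1]
  change _ = ∏ j, ((Ring.choose (-(∑ i, N i * D.levelG l i j) + N j) (N j) : ℤ) : ℂ)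
  rw [Rat.cast_intCast, Int.cast_prod]

variable {D}

lemma IsProductForm.coeff_prod_levelW {Q : I → ℕ → (MvPowerSeries I ℂ)ˣ} (h : D.IsProductForm Q)
    (l : ℕ) (N : I × Fin l →₀ ℕ) (d : I →₀ ℕ) [DecidableEq I] (hd : d.degree ≤ l) :
    coeff d (N.prod fun i k => D.levelW Q l i ^ k) =
      if d = ∑ j ∈ N.support, Finsupp.single j.1 (((j.2 : ℕ) + 1) * N j) then 1 else 0 := by
  have hS : ∀ i, Ideal.Quotient.mk (orderIdeal I ℂ (l + 1))
      (D.levelS Q l i : MvPowerSeries I ℂ) = 1 := fun i =>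
    congrArg Units.val (h.unitsMod_levelS l i)
  have hmk : Ideal.Quotient.mk (orderIdeal I ℂ (l + 1))
      (N.prod fun i k => D.levelW Q l i ^ k) = Ideal.Quotient.mk (orderIdeal I ℂ (l + 1))
      (monomial (∑ j ∈ N.support, Finsupp.single j.1 (((j.2 : ℕ) + 1) * N j)) 1) := by
    rw [← prod_X_pow_eq_monomial, Finsupp.prod, map_prod, map_prod]
    refine Finset.prod_congr rfl fun j _ => ?_
    rw [map_pow, levelW, map_mul, hS, mul_one, ← map_pow, pow_mul]
  have := Ideal.Quotient.eq.mp hmk d (Nat.lt_succ_of_le hd)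
  rw [map_sub, sub_eq_zero] at this
  rw [this, coeff_monomial]

lemma IsProductForm.coeff_subst_levelW {Q : I → ℕ → (MvPowerSeries I ℂ)ˣ}
    (h : D.IsProductForm Q) (l : ℕ) (d : I →₀ ℕ) (hd : d.degree ≤ l) :
    coeff d (subst (D.levelW Q l) (binomialProdSeries ℂ (D.levelG l))) =
      coeff d (D.KTilde 0) := by
  classical
  rw [coeff_subst (hasSubst_of_constantCoeff_zero (D.constantCoeff_levelW Q l))]
  change _ = ∑ᶠ N ∈ {N : I × ℕ+ →₀ ℕ | D.yDegree N = ⇑d}, (D.KNum 0 N : ℂ)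
  have himg : {N : I × ℕ+ →₀ ℕ | D.yDegree N = ⇑d} = Finsupp.embDomain (levelEmb I l) ''
      {N | D.yDegree (N.embDomain (levelEmb I l)) = ⇑d} := by
    ext N
    constructor
    · intro hN
      obtain ⟨N', rfl⟩ := D.exists_embDomain_eq l N d hd hN
      exact ⟨N', hN, rfl⟩
    · rintro ⟨N', hN, rfl⟩
      exact hN
  rw [himg, finsum_mem_image (Finsupp.embDomain_injective _).injOn, finsum_mem_def]
  refine finsum_congr fun N => ?_
  rw [h.coeff_prod_levelW l N d hd, Set.indicator_apply]
  simp only [Set.mem_ofPred_eq, KNum_zero_embDomain, yDegree_embDomain, DFunLike.coe_fn_eq,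
    eq_comm (a := d), smul_eq_mul, mul_ite, mul_one, mul_zero]

theorem IsQSystem.KTilde_zero_eq_det [DecidableEq I] {Q : I → ℕ → (MvPowerSeries I ℂ)ˣ}
    (h : D.IsQSystem Q) :
    D.KTilde 0 = (D.jacobianMatrix fun a => (Q a 1 : MvPowerSeries I ℂ)).det := by
  ext d
  have h1 := h.isProductForm.subst_levelW_sub_mem d.degree d (Nat.lt_succ_self _)
  rw [map_sub, sub_eq_zero, h.isProductForm.coeff_subst_levelW _ d le_rfl] at h1
  exact h1

/-! ### Passage to Laurent series in `x`. -/

variable (D)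

lemma coeff_ySubst (f : MvPowerSeries I ℂ) (c : I →₀ ℕ) :
    (D.ySubst f).coeff (-D.rootComb c) = coeff c f := by
  refine HahnSeries.embDomain_coeff (f := ⟨⟨-D.rootComb, ?_⟩, ?_⟩) (a := c)

lemma coeff_ySubst_eq_zero (f : MvPowerSeries I ℂ) (lam : D.Weight)
    (h : ∀ c, lam ≠ -D.rootComb c) : (D.ySubst f).coeff lam = 0 := by
  refine HahnSeries.embDomain_of_notMem_range ?_
  rintro ⟨c, rfl⟩
  exact h c rfl

lemma coeff_mono_mul (lam mu : D.Weight) (f : D.Laurent) :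
    (D.mono lam * f).coeff (mu + lam) = f.coeff mu := by
  rw [mono, HahnSeries.coeff_single_mul_add, one_mul]

lemma fundWeight_apply [DecidableEq I] (a b : I) :
    D.fundWeight a b = if a = b then 1 else 0 := by
  have h : D.fundWeight a b = _ :=
    @Pi.single_apply I (fun _ _ => Classical.propDecidable _) ℤ _ a 1 b
  rw [h]
  simp only [eq_comm]

/-- Since `y_c = ∏_b x_b^{-C_bc}`, the operator `x_b ∂/∂x_b` acts on series in `y` as `-∑_c C_bc y_c
∂/∂y_c`, while the prefactor `x_a` contributes `δ_ab`. -/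
lemma pderiv_mono_mul_ySubst [DecidableEq I] (f : I → MvPowerSeries I ℂ) (a b : I) :
    D.pderiv b (D.mono (D.fundWeight a) * D.ySubst (f a)) =
      D.mono (D.fundWeight a) * (D.mono (-D.fundWeight b) *
        D.ySubst (D.jacobianMatrix f a b)) := by
  have hmm : D.mono (D.fundWeight a) * D.mono (-D.fundWeight b) =
      D.mono (D.fundWeight a - D.fundWeight b) := by
    rw [mono, mono, HahnSeries.single_mul_single, one_mul, ← sub_eq_add_neg]; rfl
  rw [← mul_assoc, hmm]
  ext mu
  obtain ⟨nu, rfl⟩ : ∃ nu, mu = nu + (D.fundWeight a - D.fundWeight b) :=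
    ⟨mu - (D.fundWeight a - D.fundWeight b), by abel⟩
  rw [coeff_mono_mul]
  change (((nu + (D.fundWeight a - D.fundWeight b) : D.Weight) b : ℂ) + 1) *
    (D.mono (D.fundWeight a) * D.ySubst (f a)).coeff
      (nu + (D.fundWeight a - D.fundWeight b) + D.fundWeight b) = _
  rw [show nu + (D.fundWeight a - D.fundWeight b) + D.fundWeight b = nu + D.fundWeight a by abel,
    coeff_mono_mul]
  have happ : (nu + (D.fundWeight a - D.fundWeight b) : D.Weight) b =
      nu b + ((if a = b then 1 else 0) - 1) := by
    change nu b + (D.fundWeight a b - D.fundWeight b b) = _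
    rw [fundWeight_apply, fundWeight_apply, if_pos rfl]
  rw [happ]
  by_cases hnu : ∃ c, nu = -D.rootComb c
  · obtain ⟨c, rfl⟩ := hnu
    have hneg : (-D.rootComb c : D.Weight) b = -∑ a, (c a : ℤ) * D.cartan b a := by
      rw [← rootComb_apply]; rfl
    rw [hneg, coeff_ySubst, coeff_ySubst, jacobianMatrix, Matrix.of_apply, map_sub, map_sum]
    have hC : ∀ e, coeff c ((D.cartan b e : MvPowerSeries I ℂ) * euler ℂ e (f a)) =
        D.cartan b e * (c e * coeff c (f a)) := by
      intro e
      rw [← map_intCast (C (σ := I) (R := ℂ)), coeff_C_mul, coeff_euler]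
    simp only [hC]
    push_cast
    simp only [← mul_assoc]
    rw [← Finset.sum_mul]
    simp only [mul_comm (D.cartan b _ : ℂ)]
    split_ifs
    · ring
    · rw [map_zero]; ring
  · push Not at hnu
    rw [coeff_ySubst_eq_zero D _ _ hnu, coeff_ySubst_eq_zero D _ _ hnu, mul_zero]

theorem IsQSystem.KLaurent_zero_eq_det [DecidableEq I] {Q : I → ℕ → (MvPowerSeries I ℂ)ˣ}
    (h : D.IsQSystem Q) :
    D.KLaurent 0 = (Matrix.of fun a c => D.pderiv c (D.QLaurent Q a 1)).det := by
  have hone : D.mono 0 = 1 := rfl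
  have hM : (Matrix.of fun a c => D.pderiv c (D.QLaurent Q a 1)) =
      Matrix.of fun a b => D.mono (D.fundWeight a) *
        (Matrix.of fun a b => D.mono (-D.fundWeight b) *
          D.ySubst.mapMatrix (D.jacobianMatrix fun a => (Q a 1 : MvPowerSeries I ℂ)) a b) a b := by
    ext a b : 1
    rw [Matrix.of_apply, QLaurent, one_smul]
    exact D.pderiv_mono_mul_ySubst (fun a => (Q a 1 : MvPowerSeries I ℂ)) a b
  -- The row factors `x_a` and the column factors `x_b^{-1}` cancel in the determinant.
  rw [hM, Matrix.det_mul_column, Matrix.det_mul_row, ← mul_assoc, ← Finset.prod_mul_distrib,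
    ← RingHom.map_det, ← h.KTilde_zero_eq_det, KLaurent, Finsupp.sum_zero_index, hone,
    Finset.prod_eq_one, one_mul]
  intro a _
  rw [← hone, mono, mono, HahnSeries.single_mul_single, one_mul, add_neg_cancel]
  rfl

end CartanData

theorem propositionC3 {L : Type*} [LieRing L] [LieAlgebra ℂ L] [FiniteDimensional ℂ L]
    [LieAlgebra.IsSimple ℂ L] (𝔥 : LieSubalgebra ℂ L) [𝔥.IsCartanSubalgebra]
    (b : (LieAlgebra.IsKilling.rootSystem 𝔥).Base) [DecidableEq b.support] :
    (∃! Q : b.support → ℕ → (MvPowerSeries b.support ℂ)ˣ, b.cartanData.IsQSystem Q) ∧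
    ∀ Q : b.support → ℕ → (MvPowerSeries b.support ℂ)ˣ, b.cartanData.IsQSystem Q →
      b.cartanData.KLaurent 0 =
        (Matrix.of fun a c : b.support =>
          b.cartanData.pderiv c (b.cartanData.QLaurent Q a 1)).det :=
  ⟨b.cartanData.existsUnique_isQSystem, fun _ hQ => hQ.KLaurent_zero_eq_det⟩
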